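/- Setting. Fix a dimension $p\ge 1$, a bound $B>0$ and a confidence parameter $\delta\in(0,1)$. An unknown parameter $\theta^\star\in\mathbb R^p$ satisfies $\|\theta^\star\|_2\le B$, and $(\mathcal X_t)_{t\ge1}$ are deterministic subsets of the closed unit ball of $\mathbb R^p$. In round $t$ the agent plays $X_t\in\mathcal X_t$ and observes $Y_t=\langle\theta^\star,X_t\rangle+\varepsilon_t$. The regret is $\mathrm{Reg}(T)=\sum_{t=1}^T\sup_{x\in\mathcal X_t}\big(\langle x,\theta^\star\rangle-\langle X_t,\theta^\star\rangle\big)$. Noise. Let $\mathcal F_t=\sigma(\varepsilon_1,\dots,\varepsilon_t)$ ($\mathcal F_0$ trivial). For some $C,\tau>0$ the noise is geometrically mixing with $\phi_d=Ce^{-d/\tau}$: every $\varepsilon_t$ is centred and $1$-sub-Gaussian, and for all $1\le d<t$, almost surely, $|\mathbb E[\varepsilon_t\mid\mathcal F_{t-d}]|\le\phi_d$ and $\mathbb E\big[e^{\lambda(\varepsilon_t-\mathbb E[\varepsilon_t\mid\mathcal F_{t-d}])}\mid\mathcal F_{t-d}\big]\le e^{\lambda^2/2}$ for every $\lambda\in\mathbb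 R$. Algorithm. Mixing-LinUCB with delay $d\geq 1$ plays arbitrary non-random arms $X_t\in\mathcal X_t$ for $t\le d$, and for $t>d$ an arm $X_t$ that maximises $x\mapsto\max_{\theta\in\mathcal C_{t-d}}\langle x,\theta\rangle$ over $\mathcal X_t$, where $X_t$ is $\mathcal F_{t-d}$-measurable and ties are otherwise broken arbitrarily. Here $V_t=\sum_{s=1}^tX_sX_s^\top+B^{-2}\mathrm{Id}$, $\widehat\theta_t$ is any minimiser of $\sum_{s=1}^t(\langle\theta,X_s\rangle-Y_s)^2$ over $\|\theta\|_2\le B$, and $\mathcal C_t$ is the set of all $\theta$ with $\|\theta\|_2\le B$ and $$\tfrac12(\theta-\widehat\theta_t)^\top V_t(\theta-\widehat\theta_t)\le\tfrac{dp}2\log\tfrac{(B+1)^2e\max(dp,t+d)}{dp}+2+t\phi_d(B+1)+d\log\tfrac d\delta .$$ Claim. There is a universal constant $K>0$ with the following two properties. (i) For all $p\ge1$, $B>0$ and $\delta\in(0,1)$ there is $T_0$, depending only on $p,B,\delta$, such that for all $C,\tau>0$ and all $T\ge T_0$ with $\tau\log\frac{BCT}p\ge1$, and for all $\theta^\star$,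 all decision sets, all noise sequences and all ways of making the free choices in the algorithm as above, Mixing-LinUCB with delay $d=\lceil\tau\log\frac{BCT}p\rceil$ satisfies, with probability at least $1-\delta$, $\mathrm{Reg}(T)\le K\,\rho(T)$, where $$\rho(T)=\tau p\sqrt T\Big(\log\tfrac{TB\max(1,C)}p\Big)^2+p\sqrt{T\tau}\,\log\tfrac{TB\max(1,C)}p+\tau\log\tfrac{BCT}p\sqrt{pT\log\tfrac{TB}{p\delta}} .$$ (ii) This matches the i.i.d. rate $\rho_{\mathrm{iid}}(T)=B+p\sqrt T\log\frac{TB}p+\sqrt{pT\log\frac{TB}{p\delta}}$ up to a factor of order $\tau\log T$: for all $p\ge1$, $B,C,\tau>0$ and $\delta\in(0,1)$, and all sufficiently large $T$, one has $\frac1K\,\tau\log T\,\rho_{\mathrm{iid}}(T)\le\rho(T)\le K\,\tau\log T\,\rho_{\mathrm{iid}}(T)$. -/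

import Mathlib

open MeasureTheory ProbabilityTheory
open scoped NNReal

universe u

noncomputable section

namespace MixingBandit

/-- The parameter and action space `ℝ^p` with its Euclidean norm. -/
abbrev Vec (p : ℕ) : Type := EuclideanSpace ℝ (Fin p)

/-! ### The noise -/

/-- The noise `σ`-field `F_t = σ(ε_1, …, ε_t)`; `F_0` is trivial. Rounds are numbered from `1`, the
value `ε 0` is never used. -/
@[reducible] def noiseSigma {Ω : Type*} (ε : ℕ → Ω → ℝ) (t : ℕ) : MeasurableSpace Ω :=
  ⨆ s ∈ Finset.Icc 1 t, MeasurableSpace.comap (ε s) inferInstance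

/-- `(σ, φ)`-mixing sub-Gaussian noise `(ε_t)_{t ≥ 1}`: every `ε_t` is centred and `σ`-sub-Gaussian,
and, given the noise up to `d` rounds earlier, its conditional mean is at most `φ_d` in absolute
value and its fluctuation around the conditional mean is conditionally `σ`-sub-Gaussian. -/
structure MixingSubGaussian {Ω : Type*} [MeasurableSpace Ω] (μ : Measure Ω)
    (σ : ℝ≥0) (φ : ℕ → ℝ) (ε : ℕ → Ω → ℝ) : Prop where
  sigma_pos : 0 < σ
  coeff_nonneg : ∀ d, 0 ≤ φ d
  coeff_antitone : Antitone φ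
  measurable : ∀ t, 1 ≤ t → Measurable (ε t)
  centred : ∀ t, 1 ≤ t → ∫ ω, ε t ω ∂μ = 0
  subGaussian : ∀ t, 1 ≤ t → HasSubgaussianMGF (ε t) (σ ^ 2) μ
  condMean : ∀ d t, 1 ≤ d → d < t →
    ∀ᵐ ω ∂μ, |(μ[ε t | noiseSigma ε (t - d)]) ω| ≤ φ d
  condSubGaussian : ∀ d t, 1 ≤ d → d < t → ∀ l : ℝ,
    ∀ᵐ ω ∂μ,
      (μ[fun ω' => Real.exp (l * (ε t ω' - (μ[ε t | noiseSigma ε (t - d)]) ω'))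
          | noiseSigma ε (t - d)]) ω
        ≤ Real.exp (l ^ 2 * (σ : ℝ) ^ 2 / 2)

/-- Geometric mixing coefficients `φ_d = C e^{-d/τ}`. -/
def geometricCoeff (C τ : ℝ) (d : ℕ) : ℝ := C * Real.exp (-(d : ℝ) / τ)

/-! ### Confidence sets -/

/-- The regularised feature covariance `V_t = ∑_{s=1}^t X_s X_sᵀ + lam • 1`. -/
def featureCov {p : ℕ} (lam : ℝ) (x : ℕ → Vec p) (t : ℕ) : Matrix (Fin p) (Fin p) ℝ :=
  ∑ s ∈ Finset.Icc 1 t, Matrix.vecMulVec (x s).ofLp (x s).ofLp + lam • (1 : Matrix (Fin p) (Fin p) ℝ)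

/-- The squared weighted norm `‖u‖_A² = ⟨u, A u⟩`. -/
def weightedNormSq {p : ℕ} (A : Matrix (Fin p) (Fin p) ℝ) (u : Vec p) : ℝ :=
  u.ofLp ⬝ᵥ (A.mulVec u.ofLp)

/-- The cumulative squared error `∑_{s=1}^t (⟨θ, X_s⟩ - Y_s)²`. -/
def sqLoss {p : ℕ} (x : ℕ → Vec p) (y : ℕ → ℝ) (t : ℕ) (θ : Vec p) : ℝ :=
  ∑ s ∈ Finset.Icc 1 t, (inner ℝ θ (x s) - y s) ^ 2

/-- The radius of the confidence ellipsoid after `t` rounds (a bound for half of the squared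
weighted distance), with delay `d`, regularisation `lam` and confidence level `1 - δ`. -/
def confRadius (p d : ℕ) (B lam δ : ℝ) (φ : ℕ → ℝ) (t : ℕ) : ℝ :=
  (d : ℝ) * p / 2 *
      Real.log ((B + 1) ^ 2 * Real.exp 1 * max ((d : ℝ) * p) ((t : ℝ) + d) / ((d : ℝ) * p))
    + 2 * lam * B ^ 2 + t * φ d * (B + 1) + d * Real.log (d / δ)

/-- The confidence set `C_t`, centred at a least-squares estimate `θhat`. -/
def confSet {p : ℕ} (d : ℕ) (B lam δ : ℝ) (φ : ℕ → ℝ) (x : ℕ → Vec p) (θhat : Vec p) (t : ℕ) :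
    Set (Vec p) :=
  {θ | θ ∈ Metric.closedBall (0 : Vec p) B ∧
    1 / 2 * weightedNormSq (featureCov lam x t) (θ - θhat) ≤ confRadius p d B lam δ φ t}

/-- The upper confidence bound `UCB_S(x) = max_{θ ∈ S} ⟨x, θ⟩`. -/
def ucb {p : ℕ} (S : Set (Vec p)) (x : Vec p) : ℝ :=
  sSup ((fun θ : Vec p => inner ℝ x θ) '' S)

/-! ### The algorithm and its regret -/

/-- `X` is the sequence of arms played by Mixing-LinUCB with delay `d` (and `θhat` its sequence of
least-squares estimates) when the true parameter is `θstar`, the noise is `ε` and the decision sets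
are `𝒳`. The first `d` arms are arbitrary but not random; every later arm maximises the upper
confidence bound built from the first `t - d` rounds. The rule is not randomised: `X_t` is a
measurable function of `ε_1, …, ε_{t-d}` (for `t ≤ d` the `σ`-field is trivial). Ties in the
minimisation and in the maximisation may be broken in any way. -/
structure IsMixingLinUCB {Ω : Type*} {p : ℕ} (d : ℕ) (B lam δ : ℝ) (φ : ℕ → ℝ)
    (θstar : Vec p) (ε : ℕ → Ω → ℝ) (𝒳 : ℕ → Set (Vec p))
    (X : ℕ → Ω → Vec p) (θhat : ℕ → Ω → Vec p) : Prop where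
  measurable : ∀ t, 1 ≤ t → Measurable[noiseSigma ε (t - d)] (X t)
  mem : ∀ t, 1 ≤ t → ∀ ω, X t ω ∈ 𝒳 t
  estimate_mem : ∀ t, 1 ≤ t → ∀ ω, θhat t ω ∈ Metric.closedBall (0 : Vec p) B
  estimate_min : ∀ t, 1 ≤ t → ∀ ω,
    IsMinOn (sqLoss (fun s => X s ω) (fun s => inner ℝ θstar (X s ω) + ε s ω) t)
      (Metric.closedBall (0 : Vec p) B) (θhat t ω)
  optimistic : ∀ t, d < t → ∀ ω,
    IsMaxOn (ucb (confSet d B lam δ φ (fun s => X s ω) (θhat (t - d) ω) (t - d))) (𝒳 t) (X t ω)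

/-- The regret `Reg(T) = ∑_{t=1}^T sup_{x ∈ 𝒳_t} (⟨x, θ⋆⟩ - ⟨X_t, θ⋆⟩)`. -/
def regret {Ω : Type*} {p : ℕ} (θstar : Vec p) (𝒳 : ℕ → Set (Vec p)) (X : ℕ → Ω → Vec p)
    (T : ℕ) (ω : Ω) : ℝ :=
  ∑ t ∈ Finset.Icc 1 T, ⨆ x : 𝒳 t, (inner ℝ (x : Vec p) θstar - inner ℝ (X t ω) θstar)

/-! ### The tuning of the delay and the rates -/

/-- The delay `d = ⌈τ log (B C T / p)⌉`. -/
def geometricDelay (p : ℕ) (B C τ : ℝ) (T : ℕ) : ℕ := ⌈τ * Real.log (B * C * T / p)⌉₊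

/-- The regret rate for geometrically mixing noise. -/
def geometricRate (p : ℕ) (B C τ δ : ℝ) (T : ℕ) : ℝ :=
  τ * p * √T * Real.log (T * B * max 1 C / p) ^ 2
    + p * √(T * τ) * Real.log (T * B * max 1 C / p)
    + τ * Real.log (B * C * T / p) * √(p * T * Real.log (T * B / (p * δ)))

/-- The regret rate for i.i.d. noise: no mixing coefficient and delay `1`. -/
def iidRate (p : ℕ) (B δ : ℝ) (T : ℕ) : ℝ :=
  B + p * √T * Real.log (T * B / p) + √(p * T * Real.log (T * B / (p * δ)))

end MixingBandit

end

noncomputable section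

namespace MixingBandit

open scoped ENNReal
open Filter

/-! ### Exponential supermartingales and their mixtures -/

/-! Split the rounds into the `d` residue classes mod `d`. Inside one class the arm `X_s` and the
conditional mean `m_s = E[ε_s | F_{s-d}]` are known before round `s`, and `ε_s - m_s` is
conditionally sub-Gaussian. So `exp ∑ (⟨v, X_s⟩ (ε_s - m_s) - ⟨v, X_s⟩² / 2)` is a supermartingale
for each fixed `v`, and so is its mixture over a uniform prior on a ball. Ville's inequality at
level `d / δ` and a union bound over the classes keep all mixtures small with probability at least
`1 - δ` (`mixture_maximal`, `measure_bad_le`).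

By Jensen's inequality on a small ball, the mixture controls the exponent at the random point `u =
θhat - θstar` (`logRatio_le_of_mixture_lt`). Summing over the classes and using first-order
optimality of least squares bounds `W = ∑ ⟨u, X_s⟩²` by the stochastic part of the radius plus the
drift `∑ m_s ⟨u, X_s⟩`. As `|⟨u, X_s⟩|` may be as large as `2B`, the term `t φ_d (B + 1)` of the
radius need not cover a crude bound of the drift when `B > 1`. The drift is absorbed elsewhere: the
uniform law on the unit ball has second moment strictly below `1`, which leaves a slack `d p (1 -
ballMoment p) / 2` in the Jensen step. The tuned delay gives `φ_d ≤ p / (B T)`, so for `T` large in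
terms of `p, B, δ` only, the slack dominates (`drift_le`, `mem_confSet_of_mixture_lt`).

On this event optimism bounds each instantaneous regret by the width of the ellipsoid. The
covariance available at round `i + k d` dominates that of the first `k` arms of its own class, so
the elliptical potential lemma applies class by class with no loss from the delay (`regret_le`).
With a radius of order `d p log T` this gives regret of order `d p √T log T`, which the first term
of the rate covers. The comparison with the i.i.d. rate only uses that, asymptotically, all
logarithms involved outside the common square-root term are comparable to `log T`. -/

/-- On sets of `m` the measure with density `f` is at most `c • μ`, because there `f` and its
conditional expectation have the same integral. Integrating `g` against both trimmed measures then
needs no integrability of `g`. -/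
theorem lintegral_mul_ofReal_le_of_condExp_le {Ω : Type*} {m m0 : MeasurableSpace Ω} (hm : m ≤ m0)
    {μ : Measure Ω} [IsFiniteMeasure μ] {f : Ω → ℝ} (hf : Integrable f μ) (hfm : Measurable f)
    (hf0 : 0 ≤ f) {c : ℝ} (h : ∀ᵐ ω ∂μ, (μ[f | m]) ω ≤ c)
    {g : Ω → ℝ≥0∞} (hg : Measurable[m] g) :
    ∫⁻ ω, g ω * ENNReal.ofReal (f ω) ∂μ ≤ ENNReal.ofReal c * ∫⁻ ω, g ω ∂μ := by
  have hle : (μ.withDensity fun ω => ENNReal.ofReal (f ω)).trim hm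
      ≤ ENNReal.ofReal c • μ.trim hm := by
    refine Measure.le_iff.2 fun s hs => ?_
    rw [Measure.smul_apply, trim_measurableSet_eq hm hs, trim_measurableSet_eq hm hs,
      withDensity_apply _ (hm s hs),
      ← ofReal_integral_eq_lintegral_ofReal hf.integrableOn (ae_of_all _ hf0),
      ← setIntegral_condExp hm hf hs, smul_eq_mul, ← ofReal_measureReal (measure_ne_top μ s)]
    rw [← ENNReal.ofReal_mul' measureReal_nonneg]
    refine ENNReal.ofReal_le_ofReal ?_
    calc ∫ ω in s, (μ[f | m]) ω ∂μ ≤ ∫ _ in s, c ∂μ :=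
          setIntegral_mono_ae integrable_condExp.integrableOn (integrable_const c) h
      _ = c * μ.real s := by simp [mul_comm]
  have h1 : ∫⁻ ω, g ω * ENNReal.ofReal (f ω) ∂μ
      = ∫⁻ ω, g ω ∂((μ.withDensity fun ω => ENNReal.ofReal (f ω)).trim hm) := by
    rw [lintegral_trim hm hg,
      lintegral_withDensity_eq_lintegral_mul μ hfm.ennreal_ofReal (hg.mono hm le_rfl)]
    exact lintegral_congr fun ω => mul_comm _ _
  rw [h1, ← lintegral_trim hm hg, ← smul_eq_mul, ← lintegral_smul_measure]
  exact lintegral_mono' hle le_rfl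

/-- `η` is conditionally `1`-sub-Gaussian given `m`, in integrated form. -/
def CondSubGaussian {Ω : Type*} (m : MeasurableSpace Ω) {m0 : MeasurableSpace Ω} (μ : Measure Ω)
    (η : Ω → ℝ) : Prop :=
  ∀ (l : ℝ) (g : Ω → ℝ≥0∞), Measurable[m] g →
    ∫⁻ ω, g ω * ENNReal.ofReal (Real.exp (l * η ω - l ^ 2 / 2)) ∂μ ≤ ∫⁻ ω, g ω ∂μ

/-- Lets the exponent be predictable instead of constant, as needed for `⟨v, X_n⟩`. A finite-valued
`l` is handled fibre by fibre, a general one by simple approximation and Fatou's lemma. -/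
theorem CondSubGaussian.lintegral_le {Ω : Type*} {m m0 : MeasurableSpace Ω} (hm : m ≤ m0)
    {μ : Measure Ω} {η : Ω → ℝ} (hη : Measurable η) (h : CondSubGaussian m μ η)
    {l : Ω → ℝ} (hl : Measurable[m] l) {g : Ω → ℝ≥0∞} (hg : Measurable[m] g) :
    ∫⁻ ω, g ω * ENNReal.ofReal (Real.exp (l ω * η ω - l ω ^ 2 / 2)) ∂μ ≤ ∫⁻ ω, g ω ∂μ := by
  have hs : StronglyMeasurable[m] l := hl.stronglyMeasurable
  have hg' : Measurable g := hg.mono hm le_rfl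
  have key : ∀ φ : Ω → ℝ, Measurable[m] φ → (Set.range φ).Finite →
      ∫⁻ ω, g ω * ENNReal.ofReal (Real.exp (φ ω * η ω - φ ω ^ 2 / 2)) ∂μ ≤ ∫⁻ ω, g ω ∂μ := by
    intro φ hφ hfin
    have hfib : ∀ r, MeasurableSet[m] (φ ⁻¹' {r}) := fun r => hφ (measurableSet_singleton r)
    have hsum : ∀ G : Ω → ℝ≥0∞, ∀ ω,
        G ω = ∑ r ∈ hfin.toFinset, (φ ⁻¹' {r}).indicator G ω := by
      intro G ω
      rw [Finset.sum_eq_single (φ ω)]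
      · simp
      · intro b _ hb
        simp [Set.indicator, hb.symm]
      · intro hn
        exact absurd (hfin.mem_toFinset.2 (Set.mem_range_self ω)) hn
    calc ∫⁻ ω, g ω * ENNReal.ofReal (Real.exp (φ ω * η ω - φ ω ^ 2 / 2)) ∂μ
        = ∫⁻ ω, ∑ r ∈ hfin.toFinset, (φ ⁻¹' {r}).indicator g ω *
            ENNReal.ofReal (Real.exp (r * η ω - r ^ 2 / 2)) ∂μ := by
          refine lintegral_congr fun ω => ?_
          rw [hsum (fun ω => g ω * ENNReal.ofReal (Real.exp (φ ω * η ω - φ ω ^ 2 / 2))) ω]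
          refine Finset.sum_congr rfl fun r _ => ?_
          by_cases hr : φ ω = r
          · simp [Set.indicator, hr]
          · simp [Set.indicator, hr]
      _ = ∑ r ∈ hfin.toFinset, ∫⁻ ω, (φ ⁻¹' {r}).indicator g ω *
            ENNReal.ofReal (Real.exp (r * η ω - r ^ 2 / 2)) ∂μ := by
          refine lintegral_finsetSum _ fun r _ => ?_
          have : Measurable ((φ ⁻¹' {r}).indicator g) := hg'.indicator (hm _ (hfib r))
          fun_prop
      _ ≤ ∑ r ∈ hfin.toFinset, ∫⁻ ω, (φ ⁻¹' {r}).indicator g ω ∂μ :=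
          Finset.sum_le_sum fun r _ => h r _ (hg.indicator (hfib r))
      _ = ∫⁻ ω, g ω ∂μ := by
          rw [← lintegral_finsetSum _ fun r _ => hg'.indicator (hm _ (hfib r))]
          exact lintegral_congr fun ω => (hsum g ω).symm
  have happ : ∀ n, Measurable[m] (hs.approx n) := fun n =>
    @SimpleFunc.measurable _ _ m _ (hs.approx n)
  have hmeas : ∀ n, Measurable fun ω => g ω *
      ENNReal.ofReal (Real.exp (hs.approx n ω * η ω - hs.approx n ω ^ 2 / 2)) := by
    intro n
    have : Measurable (fun ω => hs.approx n ω) :=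
      (happ n).mono hm le_rfl
    fun_prop
  have hlim : ∀ ω, Filter.Tendsto (fun n => g ω *
      ENNReal.ofReal (Real.exp (hs.approx n ω * η ω - hs.approx n ω ^ 2 / 2))) Filter.atTop
      (nhds (g ω * ENNReal.ofReal (Real.exp (l ω * η ω - l ω ^ 2 / 2)))) := by
    intro ω
    have h0 := hs.tendsto_approx ω
    have h1 : Filter.Tendsto (fun n => ENNReal.ofReal
        (Real.exp (hs.approx n ω * η ω - hs.approx n ω ^ 2 / 2))) Filter.atTop
        (nhds (ENNReal.ofReal (Real.exp (l ω * η ω - l ω ^ 2 / 2)))) :=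
      ENNReal.tendsto_ofReal ((Real.continuous_exp.tendsto _).comp
        ((h0.mul_const _).sub ((h0.pow 2).div_const 2)))
    exact ENNReal.Tendsto.const_mul h1 (Or.inl (by simp [Real.exp_pos]))
  calc ∫⁻ ω, g ω * ENNReal.ofReal (Real.exp (l ω * η ω - l ω ^ 2 / 2)) ∂μ
      = ∫⁻ ω, Filter.liminf (fun n => g ω *
          ENNReal.ofReal (Real.exp (hs.approx n ω * η ω - hs.approx n ω ^ 2 / 2)))
          Filter.atTop ∂μ := lintegral_congr fun ω => (hlim ω).liminf_eq.symm
    _ ≤ Filter.liminf (fun n => ∫⁻ ω, g ω *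
          ENNReal.ofReal (Real.exp (hs.approx n ω * η ω - hs.approx n ω ^ 2 / 2)) ∂μ)
          Filter.atTop := lintegral_liminf_le hmeas
    _ ≤ ∫⁻ ω, g ω ∂μ := Filter.liminf_le_of_le (by isBoundedDefault) fun b hb => by
          obtain ⟨n, hn⟩ := hb.exists
          exact hn.trans (key _ (happ n) (@SimpleFunc.finite_range _ _ m (hs.approx n)))

/-- **Ville's inequality** for a nonnegative supermartingale, up to a finite horizon. -/
theorem ville {Ω : Type*} {m0 : MeasurableSpace Ω} {μ : Measure Ω} {𝒢 : ℕ → MeasurableSpace Ω}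
    (hmono : Monotone 𝒢) (hle : ∀ n, 𝒢 n ≤ m0) {N : ℕ → Ω → ℝ≥0∞}
    (hN : ∀ n, Measurable[𝒢 n] (N n))
    (hsup : ∀ n A, MeasurableSet[𝒢 n] A → ∫⁻ ω in A, N (n + 1) ω ∂μ ≤ ∫⁻ ω in A, N n ω ∂μ)
    (a : ℝ≥0∞) (n : ℕ) :
    a * μ {ω | ∃ k ≤ n, a ≤ N k ω} ≤ ∫⁻ ω, N 0 ω ∂μ := by
  set E : ℕ → Set Ω := fun n => {ω | ∃ k ≤ n, a ≤ N k ω} with hE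
  have hEm : ∀ n, MeasurableSet[𝒢 n] (E n) := by
    intro n
    have : E n = ⋃ k ∈ Set.Iic n, {ω | a ≤ N k ω} := by ext; simp [hE]
    rw [this]
    refine @MeasurableSet.biUnion _ _ (𝒢 n) _ _ (Set.to_countable _) fun k hk => ?_
    exact ((hN k).mono (hmono hk) le_rfl) measurableSet_Ici
  -- The process stopped on reaching `a`: mass at least `a` is frozen on `E n`, and the
  -- supermartingale property is used only on the complement.
  have key : ∀ n, a * μ (E n) + ∫⁻ ω in (E n)ᶜ, N n ω ∂μ ≤ ∫⁻ ω, N 0 ω ∂μ := by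
    intro n
    induction n with
    | zero =>
      refine le_trans (add_le_add ?_ le_rfl)
        (lintegral_add_compl (μ := μ) (N 0) (hle 0 _ (hEm 0))).le
      rw [← setLIntegral_const]
      refine setLIntegral_mono ((hN 0).mono (hle 0) le_rfl) fun ω hω => ?_
      obtain ⟨k, hk, h⟩ := hω
      obtain rfl : k = 0 := by omega
      exact h
    | succ n ih =>
      refine le_trans ?_ ih
      have hsub : E n ⊆ E (n + 1) := fun ω ⟨k, hk, h⟩ => ⟨k, hk.trans (Nat.le_succ n), h⟩
      have hmE : MeasurableSet (E n) := hle n _ (hEm n)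
      have hmE' : MeasurableSet (E (n + 1)) := hle _ _ (hEm (n + 1))
      have hstep := hsup n (E n)ᶜ (hEm n).compl
      refine le_trans ?_ (add_le_add_right hstep _)
      rw [← lintegral_inter_add_sdiff (μ := μ) (N (n + 1)) (E n)ᶜ hmE', ← add_assoc]
      have h1 : (E n)ᶜ ∩ E (n + 1) = E (n + 1) \ E n := by ext; simp [and_comm]
      have h2 : (E n)ᶜ \ E (n + 1) = (E (n + 1))ᶜ := by
        ext ω
        simp only [Set.mem_sdiff, Set.mem_compl_iff]
        exact ⟨fun h => h.2, fun h => ⟨fun h' => h (hsub h'), h⟩⟩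
      rw [h1, h2]
      gcongr
      have h3 : μ (E (n + 1)) = μ (E n) + μ (E (n + 1) \ E n) := by
        rw [← measure_inter_add_sdiff (E (n + 1)) hmE, Set.inter_eq_self_of_subset_right hsub]
      rw [h3, mul_add]
      gcongr
      rw [← setLIntegral_const]
      refine setLIntegral_mono ((hN (n + 1)).mono (hle _) le_rfl) fun ω hω => ?_
      obtain ⟨⟨k, hk, h⟩, h'⟩ := hω
      rcases Nat.lt_or_ge k (n + 1) with hlt | hge
      · exact absurd ⟨k, Nat.lt_succ_iff.1 hlt, h⟩ h'
      · obtain rfl : k = n + 1 := le_antisymm hk hge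
        exact h
  exact le_trans le_self_add (key n)

/-- The exponent of the likelihood-ratio process at the point `v`. -/
def logRatio {p : ℕ} (x : ℕ → Vec p) (η : ℕ → ℝ) (n : ℕ) (v : Vec p) : ℝ :=
  ∑ k ∈ Finset.range n, (inner ℝ v (x k) * η k - inner ℝ v (x k) ^ 2 / 2)

theorem measurable_ofReal_exp_logRatio {α : Type*} [MeasurableSpace α] {p : ℕ}
    {x : ℕ → α → Vec p} {η : ℕ → α → ℝ} {v : α → Vec p} {n : ℕ} (hx : ∀ k < n, Measurable (x k))
    (hη : ∀ k < n, Measurable (η k)) (hv : Measurable v) :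
    Measurable fun z => ENNReal.ofReal
      (Real.exp (logRatio (fun s => x s z) (fun s => η s z) n (v z))) := by
  refine ENNReal.measurable_ofReal.comp (Real.measurable_exp.comp ?_)
  unfold logRatio
  refine Finset.measurable_sum _ fun k hk => ?_
  have h1 := hx k (Finset.mem_range.1 hk)
  have h2 := hη k (Finset.mem_range.1 hk)
  fun_prop

theorem measurable_ofReal_exp_logRatio_prod {α : Type*} [MeasurableSpace α] {p : ℕ}
    {x : ℕ → α → Vec p} {η : ℕ → α → ℝ} {n : ℕ} (hx : ∀ k < n, Measurable (x k))
    (hη : ∀ k < n, Measurable (η k)) :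
    Measurable fun z : α × Vec p => ENNReal.ofReal
      (Real.exp (logRatio (fun s => x s z.1) (fun s => η s z.1) n z.2)) :=
  measurable_ofReal_exp_logRatio (x := fun k (z : α × Vec p) => x k z.1)
    (η := fun k (z : α × Vec p) => η k z.1)
    (fun k hk => (hx k hk).comp measurable_fst)
    (fun k hk => (hη k hk).comp measurable_fst) measurable_snd

theorem measurable_mixture {α : Type*} [MeasurableSpace α] {p : ℕ}
    {x : ℕ → α → Vec p} {η : ℕ → α → ℝ} {n : ℕ} (hx : ∀ k < n, Measurable (x k))
    (hη : ∀ k < n, Measurable (η k)) (Q : Measure (Vec p)) [SFinite Q] :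
    Measurable fun ω => ∫⁻ v, ENNReal.ofReal
      (Real.exp (logRatio (fun s => x s ω) (fun s => η s ω) n v)) ∂Q :=
  (measurable_ofReal_exp_logRatio_prod hx hη).lintegral_prod_right'

/-- A mixture of the likelihood-ratio processes satisfies a maximal inequality. -/
theorem mixture_maximal {Ω : Type*} {m0 : MeasurableSpace Ω} {μ : Measure Ω}
    [IsProbabilityMeasure μ] {p : ℕ} {𝒢 : ℕ → MeasurableSpace Ω}
    (hmono : Monotone 𝒢) (hle : ∀ n, 𝒢 n ≤ m0) {x : ℕ → Ω → Vec p} {η : ℕ → Ω → ℝ}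
    (hx : ∀ n, Measurable[𝒢 n] (x n)) (hη : ∀ n, Measurable[𝒢 (n + 1)] (η n))
    (hsub : ∀ n, CondSubGaussian (𝒢 n) μ (η n)) (Q : Measure (Vec p)) [IsProbabilityMeasure Q]
    (a : ℝ≥0∞) (n : ℕ) :
    a * μ {ω | ∃ k ≤ n, a ≤ ∫⁻ v, ENNReal.ofReal
      (Real.exp (logRatio (fun s => x s ω) (fun s => η s ω) k v)) ∂Q} ≤ 1 := by
  have hx' : ∀ n, ∀ k < n, Measurable[𝒢 n] (x k) := fun n k hk =>
    (hx k).mono (hmono hk.le) le_rfl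
  have hη' : ∀ n, ∀ k < n, Measurable[𝒢 n] (η k) := fun n k hk => (hη k).mono (hmono hk) le_rfl
  have := ville (μ := μ) hmono hle (N := fun k ω => ∫⁻ v, ENNReal.ofReal
      (Real.exp (logRatio (fun s => x s ω) (fun s => η s ω) k v)) ∂Q) ?_ ?_ a n
  · refine this.trans ?_
    simp [logRatio]
  · exact fun n => @measurable_mixture _ (𝒢 n) _ _ _ _ (hx' n) (hη' n) Q _
  · intro n A hA
    have hA' : MeasurableSet A := hle n A hA
    have hmeas := fun n => measurable_ofReal_exp_logRatio_prod (n := n)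
      (fun k hk => (hx' n k hk).mono (hle n) le_rfl) (fun k hk => (hη' n k hk).mono (hle n) le_rfl)
    -- By Tonelli's theorem the supermartingale inequality may be checked for each fixed `v`.
    refine (lintegral_lintegral_swap (hmeas (n + 1)).aemeasurable).trans_le
      (le_trans (lintegral_mono fun v => ?_)
        (lintegral_lintegral_swap (hmeas n).aemeasurable).ge)
    rw [← lintegral_indicator hA', ← lintegral_indicator hA']
    have hl : Measurable[𝒢 n] fun ω => (inner ℝ v (x n ω) : ℝ) :=
      (hx n).const_inner
    have hv := @measurable_ofReal_exp_logRatio Ω (𝒢 n) p x η (fun _ => v) n (hx' n) (hη' n)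
      (@measurable_const _ _ _ (𝒢 n) v)
    refine le_trans (le_of_eq ?_) ((hsub n).lintegral_le (hle n)
      ((hη n).mono (hle _) le_rfl) hl (hv.indicator hA))
    refine lintegral_congr fun ω => ?_
    by_cases hω : ω ∈ A
    · simp only [Set.indicator_of_mem hω]
      rw [← ENNReal.ofReal_mul (Real.exp_nonneg _), ← Real.exp_add]
      rw [logRatio, Finset.sum_range_succ, logRatio]
    · simp [Set.indicator_of_notMem hω]

/-! ### The uniform prior on a ball -/

/-- The second moment of the uniform distribution on the unit ball. -/
def ballMoment (p : ℕ) : ℝ :=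
  (∫ z in Metric.closedBall (0 : Vec p) 1, ‖z‖ ^ 2) / volume.real (Metric.closedBall (0 : Vec p) 1)

theorem volume_real_closedBall_pos {p : ℕ} (u : Vec p) {c : ℝ} (hc : 0 < c) :
    0 < volume.real (Metric.closedBall u c) :=
  ENNReal.toReal_pos (Metric.measure_closedBall_pos _ _ hc).ne' measure_closedBall_lt_top.ne

theorem integrableOn_closedBall {p : ℕ} {f : Vec p → ℝ} (hf : Continuous f) (u : Vec p) (c : ℝ) :
    IntegrableOn f (Metric.closedBall u c) :=
  hf.continuousOn.integrableOn_compact (isCompact_closedBall _ _)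

theorem ballMoment_nonneg (p : ℕ) : 0 ≤ ballMoment p :=
  div_nonneg (integral_nonneg fun _ => by positivity) measureReal_nonneg

/-- The strictness is essential: `1 - ballMoment p` is the slack that later pays for the drift of
the noise. -/
theorem ballMoment_lt_one (p : ℕ) : ballMoment p < 1 := by
  have hpos := volume_real_closedBall_pos (0 : Vec p) one_pos
  rw [ballMoment, div_lt_one hpos]
  have hc : Continuous fun z : Vec p => 1 - ‖z‖ ^ 2 := by fun_prop
  have h0 : 0 < ∫ z in Metric.closedBall (0 : Vec p) 1, (1 - ‖z‖ ^ 2) := by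
    rw [setIntegral_pos_iff_support_of_nonneg_ae]
    · refine lt_of_lt_of_le (Metric.measure_ball_pos volume (0 : Vec p) one_pos)
        (measure_mono fun z hz => ⟨?_, Metric.ball_subset_closedBall hz⟩)
      have hz' : ‖z‖ < 1 := by simpa using hz
      have : ‖z‖ ^ 2 < 1 := by nlinarith [norm_nonneg z]
      simp only [Function.mem_support]
      linarith
    · refine (ae_restrict_iff' measurableSet_closedBall).2 (ae_of_all _ fun z hz => ?_)
      have hz' : ‖z‖ ≤ 1 := by simpa using hz
      have : ‖z‖ ^ 2 ≤ 1 := by nlinarith [norm_nonneg z]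
      simpa using this
    · exact integrableOn_closedBall hc _ _
  rw [integral_sub (integrableOn_closedBall continuous_const _ _) (integrableOn_closedBall (by fun_prop) _ _)] at h0
  simpa using h0

theorem setIntegral_closedBall_norm_sq {p : ℕ} {c : ℝ} (hc : 0 < c) :
    ∫ z in Metric.closedBall (0 : Vec p) c, ‖z‖ ^ 2
      = c ^ 2 * ballMoment p * volume.real (Metric.closedBall (0 : Vec p) c) := by
  have h := Measure.setIntegral_comp_smul_of_pos (volume : Measure (Vec p))
    (fun z => ‖z‖ ^ 2) (Metric.closedBall (0 : Vec p) 1) hc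
  rw [smul_closedBall _ _ zero_le_one, smul_zero, Real.norm_of_nonneg hc.le, mul_one] at h
  have hpos := volume_real_closedBall_pos (0 : Vec p) one_pos
  have hcp : (0 : ℝ) < c ^ Module.finrank ℝ (Vec p) := by positivity
  rw [Measure.addHaar_real_closedBall' volume (0 : Vec p) hc.le, ballMoment]
  have h2 : ∫ z in Metric.closedBall (0 : Vec p) 1, ‖c • z‖ ^ 2
      = c ^ 2 * ∫ z in Metric.closedBall (0 : Vec p) 1, ‖z‖ ^ 2 := by
    rw [← integral_const_mul]
    refine integral_congr_ae (ae_of_all _ fun z => ?_)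
    simp [norm_smul, mul_pow]
  rw [h2, smul_eq_mul, eq_inv_mul_iff_mul_eq₀ hcp.ne'] at h
  rw [← h]
  field_simp

theorem setIntegral_closedBall_linear {p : ℕ} (L : Vec p →ₗ[ℝ] ℝ) (c : ℝ) :
    ∫ z in Metric.closedBall (0 : Vec p) c, L z = 0 := by
  have h : ∫ z in Metric.closedBall (0 : Vec p) c, L (-z)
      = ∫ z in Metric.closedBall (0 : Vec p) c, L z := by
    have := (Measure.measurePreserving_neg (volume : Measure (Vec p))).setIntegral_preimage_emb
      (MeasurableEquiv.neg (Vec p)).measurableEmbedding L (Metric.closedBall (0 : Vec p) c)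
    simpa using this
  simp only [map_neg, integral_neg] at h
  linarith

/-- Jensen's inequality on a small ball, for a function bounded below by a quadratic. -/
theorem mul_exp_le_setIntegral_closedBall {p : ℕ} {f : Vec p → ℝ} (hf : Continuous f) {u : Vec p}
    (L : Vec p →ₗ[ℝ] ℝ) {b c : ℝ} (hc : 0 < c)
    (h : ∀ z, f u + L z - b / 2 * ‖z‖ ^ 2 ≤ f (u + z)) :
    volume.real (Metric.closedBall (0 : Vec p) c) * Real.exp (f u - b / 2 * (c ^ 2 * ballMoment p))
      ≤ ∫ v in Metric.closedBall u c, Real.exp (f v) := by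
  set a := f u - b / 2 * (c ^ 2 * ballMoment p) with ha
  have htr : ∫ v in Metric.closedBall u c, Real.exp (f v)
      = ∫ z in Metric.closedBall (0 : Vec p) c, Real.exp (f (u + z)) := by
    have := (measurePreserving_add_left (volume : Measure (Vec p)) u).setIntegral_preimage_emb
      (MeasurableEquiv.addLeft u).measurableEmbedding (fun v => Real.exp (f v))
      (Metric.closedBall u c)
    rw [← this]
    congr 2
    simp
  have hLc : Continuous L := L.continuous_of_finiteDimensional
  -- Jensen through the tangent line of `exp` at `a`, where `a` is the average over the ball of the
  -- quadratic lower bound. The linear term averages to zero by symmetry.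
  have hq : ∫ z in Metric.closedBall (0 : Vec p) c,
      Real.exp a * (1 + (f u + L z - b / 2 * ‖z‖ ^ 2 - a))
      = volume.real (Metric.closedBall (0 : Vec p) c) * Real.exp a := by
    have h1 : ∀ z, Real.exp a * (1 + (f u + L z - b / 2 * ‖z‖ ^ 2 - a))
        = Real.exp a * (1 + f u - a) + (Real.exp a * L z - Real.exp a * (b / 2) * ‖z‖ ^ 2) :=
      fun z => by ring
    simp_rw [h1]
    rw [integral_add (integrableOn_closedBall continuous_const _ _) (integrableOn_closedBall (by fun_prop) _ _),
      integral_sub (integrableOn_closedBall (by fun_prop) _ _)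
        (integrableOn_closedBall (by fun_prop) _ _),
      integral_const_mul (Real.exp a) L, integral_const_mul (Real.exp a * (b / 2)), setIntegral_closedBall_norm_sq hc,
      setIntegral_closedBall_linear]
    simp only [integral_const, MeasurableSet.univ, measureReal_restrict_apply, Set.univ_inter,
      smul_eq_mul]
    rw [ha]
    ring
  rw [htr, ← hq]
  refine setIntegral_mono (integrableOn_closedBall (by fun_prop) _ _)
    (integrableOn_closedBall (by fun_prop) _ _) fun z => ?_
  have h1 := Real.add_one_le_exp (f (u + z) - a)
  have h2 := h z
  calc Real.exp a * (1 + (f u + L z - b / 2 * ‖z‖ ^ 2 - a))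
      ≤ Real.exp a * Real.exp (f (u + z) - a) := by
        gcongr
        linarith
    _ = Real.exp (f (u + z)) := by rw [← Real.exp_add]; congr 1; ring

theorem continuous_logRatio {p : ℕ} (x : ℕ → Vec p) (η : ℕ → ℝ) (n : ℕ) :
    Continuous (logRatio x η n) := by
  unfold logRatio
  fun_prop

/-- The exponent is quadratic in `v` with Hessian `-∑ x_k x_kᵀ`, which is at least `-n` times the
identity for arms in the unit ball; `L` is its gradient at `u`. -/
theorem logRatio_add_ge {p : ℕ} {x : ℕ → Vec p} {η : ℕ → ℝ} {n : ℕ}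
    (hx : ∀ k < n, ‖x k‖ ≤ 1) (u : Vec p) :
    ∃ L : Vec p →ₗ[ℝ] ℝ, ∀ z, logRatio x η n u + L z - (n : ℝ) / 2 * ‖z‖ ^ 2
      ≤ logRatio x η n (u + z) := by
  refine ⟨innerₗ (Vec p) (∑ k ∈ Finset.range n, (η k - inner ℝ u (x k)) • x k), fun z => ?_⟩
  have h1 : (n : ℝ) / 2 * ‖z‖ ^ 2 = ∑ _k ∈ Finset.range n, ‖z‖ ^ 2 / 2 := by
    simp
    ring
  rw [h1, innerₗ_apply_apply, sum_inner]
  unfold logRatio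
  rw [← Finset.sum_add_distrib, ← Finset.sum_sub_distrib]
  refine Finset.sum_le_sum fun k hk => ?_
  have hxk := hx k (Finset.mem_range.1 hk)
  have h2 : inner ℝ z (x k) ^ 2 ≤ ‖z‖ ^ 2 := by
    rw [← sq_abs]
    have h3 := abs_real_inner_le_norm z (x k)
    have : |inner ℝ z (x k)| ≤ ‖z‖ := h3.trans (mul_le_of_le_one_right (norm_nonneg _) hxk)
    gcongr
  rw [real_inner_smul_left, inner_add_left, real_inner_comm z (x k)]
  nlinarith

/-- The likelihood ratio is controlled pointwise by its mixture under the uniform prior. -/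
theorem logRatio_le_of_mixture_lt {p : ℕ} {x : ℕ → Vec p} {η : ℕ → ℝ} {n : ℕ}
    (hx : ∀ k < n, ‖x k‖ ≤ 1) {w u : Vec p} {R c a : ℝ} (hcR : 0 < R) (hc : 0 < c) (ha : 0 < a)
    (hu : Metric.closedBall u c ⊆ Metric.closedBall w R)
    (hlt : ∫⁻ v, ENNReal.ofReal (Real.exp (logRatio x η n v))
      ∂(ProbabilityTheory.cond volume (Metric.closedBall w R)) < ENNReal.ofReal a) :
    logRatio x η n u ≤ Real.log a + p * Real.log (R / c) + n / 2 * (c ^ 2 * ballMoment p) := by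
  obtain ⟨L, hL⟩ := logRatio_add_ge (η := η) hx u
  have hJ := mul_exp_le_setIntegral_closedBall (continuous_logRatio x η n) L hc hL
  have hint : ENNReal.ofReal (∫ v in Metric.closedBall u c, Real.exp (logRatio x η n v))
      ≤ ENNReal.ofReal (a * volume.real (Metric.closedBall w R)) := by
    rw [ofReal_integral_eq_lintegral_ofReal (integrableOn_closedBall
      (continuous_logRatio x η n).rexp _ _)
      (ae_of_all _ fun _ => (Real.exp_pos _).le)]
    refine (lintegral_mono_set hu).trans ?_
    rw [ProbabilityTheory.cond, lintegral_smul_measure, smul_eq_mul] at hlt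
    have hV0 : volume (Metric.closedBall w R) ≠ 0 := (Metric.measure_closedBall_pos _ _ hcR).ne'
    have hVt : volume (Metric.closedBall w R) ≠ ⊤ := measure_closedBall_lt_top.ne
    rw [ENNReal.ofReal_mul ha.le, ofReal_measureReal hVt]
    rw [mul_comm, ← div_eq_mul_inv] at hlt
    exact (ENNReal.div_le_iff hV0 hVt).1 hlt.le
  have hint' := (ENNReal.ofReal_le_ofReal_iff (by positivity)).1 hint
  have h1 := hJ.trans hint'
  -- The ratio of the two volumes is `(c / R) ^ p`, the source of the term `p * log (R / c)`.
  rw [Measure.addHaar_real_closedBall' volume (0 : Vec p) hc.le,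
    Measure.addHaar_real_closedBall' volume w hcR.le, finrank_euclideanSpace_fin] at h1
  have hpos := volume_real_closedBall_pos (0 : Vec p) one_pos
  have h2 : c ^ p * Real.exp (logRatio x η n u - n / 2 * (c ^ 2 * ballMoment p)) ≤ a * R ^ p := by
    refine le_of_mul_le_mul_right ?_ hpos
    linarith
  have h3 := Real.log_le_log (by positivity) h2
  rw [Real.log_mul (by positivity) (Real.exp_pos _).ne', Real.log_exp, Real.log_pow,
    Real.log_mul ha.ne' (by positivity), Real.log_pow] at h3
  rw [Real.log_div hcR.ne' hc.ne']
  linarith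

/-! ### The residual noise -/

theorem noiseSigma_mono {Ω : Type*} (ε : ℕ → Ω → ℝ) : Monotone (noiseSigma ε) := fun _ _ h =>
  iSup₂_le fun k hk => le_iSup₂_of_le k
    (Finset.mem_Icc.2 ⟨(Finset.mem_Icc.1 hk).1, (Finset.mem_Icc.1 hk).2.trans h⟩) le_rfl

theorem noiseSigma_le {Ω : Type*} [m0 : MeasurableSpace Ω] {ε : ℕ → Ω → ℝ}
    (h : ∀ t, 1 ≤ t → Measurable (ε t)) (t : ℕ) : noiseSigma ε t ≤ m0 :=
  iSup₂_le fun k hk => (h k (Finset.mem_Icc.1 hk).1).comap_le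

theorem noiseSigma_zero {Ω : Type*} (ε : ℕ → Ω → ℝ) : noiseSigma ε 0 = ⊥ := by
  simp [noiseSigma]

theorem measurable_noise {Ω : Type*} (ε : ℕ → Ω → ℝ) {s t : ℕ} (hs : 1 ≤ s) (hst : s ≤ t) :
    Measurable[noiseSigma ε t] (ε s) :=
  Measurable.mono (comap_measurable (ε s))
    (le_iSup₂_of_le s (Finset.mem_Icc.2 ⟨hs, hst⟩) le_rfl) le_rfl

/-- The conditional mean of `ε_s` given the noise up to `d` rounds earlier. -/
def noiseMean {Ω : Type*} [MeasurableSpace Ω] (μ : Measure Ω) (ε : ℕ → Ω → ℝ) (d s : ℕ) : Ω → ℝ :=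
  μ[ε s | noiseSigma ε (s - d)]

theorem measurable_noiseMean {Ω : Type*} [MeasurableSpace Ω] (μ : Measure Ω) (ε : ℕ → Ω → ℝ)
    (d s : ℕ) : Measurable[noiseSigma ε (s - d)] (noiseMean μ ε d s) :=
  stronglyMeasurable_condExp.measurable

section Noise

variable {Ω : Type*} [m0 : MeasurableSpace Ω] {μ : Measure Ω} [IsProbabilityMeasure μ]
  {φ : ℕ → ℝ} {ε : ℕ → Ω → ℝ}

theorem noiseMean_eq_zero (h : MixingSubGaussian μ 1 φ ε) {d s : ℕ} (hs : 1 ≤ s) (hsd : s ≤ d) :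
    noiseMean μ ε d s = 0 := by
  rw [noiseMean, Nat.sub_eq_zero_of_le hsd, noiseSigma_zero, condExp_bot, h.centred s hs]
  rfl

theorem abs_noiseMean_le (h : MixingSubGaussian μ 1 φ ε) {d s : ℕ} (hd : 1 ≤ d) (hs : 1 ≤ s) :
    ∀ᵐ ω ∂μ, |noiseMean μ ε d s ω| ≤ φ d := by
  rcases Nat.lt_or_ge d s with hlt | hge
  · exact h.condMean d s hd hlt
  · rw [noiseMean_eq_zero h hs hge]
    exact ae_of_all _ fun ω => by simpa using h.coeff_nonneg d

/-- For `s ≤ d` the conditioning field is trivial and the mean is zero, so unconditional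
sub-Gaussianity takes over. -/
theorem condSubGaussian_residual (h : MixingSubGaussian μ 1 φ ε) {d s : ℕ} (hd : 1 ≤ d)
    (hs : 1 ≤ s) :
    CondSubGaussian (noiseSigma ε (s - d)) μ fun ω => ε s ω - noiseMean μ ε d s ω := by
  intro l g hg
  have hle := noiseSigma_le h.measurable (s - d)
  have hε := h.measurable s hs
  have hm : Measurable (noiseMean μ ε d s) := (measurable_noiseMean μ ε d s).mono hle le_rfl
  have hfm : Measurable fun ω => Real.exp (l * (ε s ω - noiseMean μ ε d s ω)) := by fun_prop
  -- Subtracting an almost surely bounded conditional mean costs at most a constant factor in the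
  -- exponential.
  have hint : Integrable (fun ω => Real.exp (l * (ε s ω - noiseMean μ ε d s ω))) μ := by
    refine (((h.subGaussian s hs).integrable_exp_mul l).const_mul
      (Real.exp (|l| * φ d))).mono' hfm.aestronglyMeasurable ?_
    filter_upwards [abs_noiseMean_le h hd hs] with ω hω
    rw [Real.norm_of_nonneg (Real.exp_pos _).le, ← Real.exp_add]
    refine Real.exp_le_exp.2 ?_
    have h1 : -(l * noiseMean μ ε d s ω) ≤ |l| * φ d := by
      refine (neg_le_abs _).trans ?_
      rw [abs_mul]
      gcongr
    linarith
  have hc : ∀ᵐ ω ∂μ, (μ[fun ω => Real.exp (l * (ε s ω - noiseMean μ ε d s ω)) |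
      noiseSigma ε (s - d)]) ω ≤ Real.exp (l ^ 2 / 2) := by
    rcases Nat.lt_or_ge d s with hlt | hge
    · filter_upwards [h.condSubGaussian d s hd hlt l] with ω hω
      simpa [noiseMean] using hω
    · refine ae_of_all _ fun ω => ?_
      rw [noiseMean_eq_zero h hs hge, Nat.sub_eq_zero_of_le hge, noiseSigma_zero, condExp_bot]
      simpa [mgf] using (h.subGaussian s hs).mgf_le l
  have key := lintegral_mul_ofReal_le_of_condExp_le hle hint hfm (fun _ => (Real.exp_pos _).le) hc hg
  have h1 : ∀ ω, g ω * ENNReal.ofReal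
      (Real.exp (l * (ε s ω - noiseMean μ ε d s ω) - l ^ 2 / 2))
      = ENNReal.ofReal (Real.exp (-(l ^ 2 / 2))) * (g ω * ENNReal.ofReal
        (Real.exp (l * (ε s ω - noiseMean μ ε d s ω)))) := by
    intro ω
    rw [sub_eq_add_neg, Real.exp_add, ENNReal.ofReal_mul (Real.exp_pos _).le]
    ring
  calc ∫⁻ ω, g ω * ENNReal.ofReal
        (Real.exp (l * (ε s ω - noiseMean μ ε d s ω) - l ^ 2 / 2)) ∂μ
      = ENNReal.ofReal (Real.exp (-(l ^ 2 / 2))) * ∫⁻ ω, g ω * ENNReal.ofReal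
        (Real.exp (l * (ε s ω - noiseMean μ ε d s ω))) ∂μ := by
        simp_rw [h1]
        exact lintegral_const_mul _ ((hg.mono hle le_rfl).mul hfm.ennreal_ofReal)
    _ ≤ ENNReal.ofReal (Real.exp (-(l ^ 2 / 2))) *
          (ENNReal.ofReal (Real.exp (l ^ 2 / 2)) * ∫⁻ ω, g ω ∂μ) := by gcongr
    _ = ∫⁻ ω, g ω ∂μ := by
        rw [← mul_assoc, ← ENNReal.ofReal_mul (Real.exp_pos _).le, ← Real.exp_add]
        simp

/-- The mixed likelihood ratio of the `i`-th residue class of rounds. -/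
def blockMixture {p : ℕ} (Q : Measure (Vec p)) (d : ℕ) (x : ℕ → Vec p) (η : ℕ → ℝ) (i n : ℕ) :
    ℝ≥0∞ :=
  ∫⁻ v, ENNReal.ofReal
    (Real.exp (logRatio (fun k => x (i + k * d)) (fun k => η (i + k * d)) n v)) ∂Q

/-- Along one class the filtration is `F_{i + n d - d}`: the delay makes the `n`-th arm measurable
for it, and the `n`-th residual is known one step later. Truncated subtraction makes the field at `n
= 0` trivial for `i ≤ d`. -/
theorem measure_blockMixture_ge (h : MixingSubGaussian μ 1 φ ε) {p d : ℕ} (hd : 1 ≤ d)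
    {X : ℕ → Ω → Vec p} (hX : ∀ t, 1 ≤ t → Measurable[noiseSigma ε (t - d)] (X t))
    (Q : Measure (Vec p)) [IsProbabilityMeasure Q] {i : ℕ} (hi : 1 ≤ i) (a : ℝ≥0∞) (n : ℕ) :
    a * μ {ω | ∃ k ≤ n, a ≤ blockMixture Q d (fun s => X s ω)
      (fun s => ε s ω - noiseMean μ ε d s ω) i k} ≤ 1 := by
  refine mixture_maximal (𝒢 := fun n => noiseSigma ε (i + n * d - d))
    (x := fun k => X (i + k * d))
    (η := fun k ω => ε (i + k * d) ω - noiseMean μ ε d (i + k * d) ω)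
    ?_ (fun n => noiseSigma_le h.measurable _) (fun n => hX _ (by omega)) ?_
    (fun n => condSubGaussian_residual h hd (by omega)) Q a n
  · intro k l hkl
    refine noiseSigma_mono ε ?_
    have : k * d ≤ l * d := Nat.mul_le_mul_right d hkl
    omega
  · intro k
    have h1 : i + (k + 1) * d - d = i + k * d := by
      rw [add_mul, one_mul, ← add_assoc, Nat.add_sub_cancel]
    refine Measurable.mono (ma := noiseSigma ε (i + k * d)) ?_
      (congrArg (noiseSigma ε) h1).ge le_rfl
    exact (measurable_noise ε (by omega) le_rfl).sub
      ((measurable_noiseMean μ ε d _).mono (noiseSigma_mono ε (Nat.sub_le _ _)) le_rfl)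

/-- Outside an event of probability at most `δ`, all conditional means are small and all block
mixtures stay below `d / δ`. -/
theorem measure_bad_le (h : MixingSubGaussian μ 1 φ ε) {p d : ℕ} (hd : 1 ≤ d)
    {X : ℕ → Ω → Vec p} (hX : ∀ t, 1 ≤ t → Measurable[noiseSigma ε (t - d)] (X t))
    (Q : Measure (Vec p)) [IsProbabilityMeasure Q] {δ : ℝ} (hδ : 0 < δ) (T : ℕ) :
    μ {ω | ¬ ((∀ s, 1 ≤ s → |noiseMean μ ε d s ω| ≤ φ d) ∧
      ∀ i ∈ Finset.Icc 1 d, ∀ k ≤ T, blockMixture Q d (fun s => X s ω)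
        (fun s => ε s ω - noiseMean μ ε d s ω) i k < ENNReal.ofReal (d / δ))}
      ≤ ENNReal.ofReal δ := by
  have hd0 : (0 : ℝ) < d := by exact_mod_cast hd
  set a := ENNReal.ofReal (d / δ) with ha
  have ha0 : a ≠ 0 := by
    rw [ha, Ne, ENNReal.ofReal_eq_zero, not_le]
    positivity
  have hat : a ≠ ⊤ := ENNReal.ofReal_ne_top
  set bad : ℕ → Set Ω := fun i => {ω | ∃ k ≤ T, a ≤ blockMixture Q d (fun s => X s ω)
      (fun s => ε s ω - noiseMean μ ε d s ω) i k} with hbad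
  have hnull : μ {ω | ¬ ∀ s, 1 ≤ s → |noiseMean μ ε d s ω| ≤ φ d} = 0 := by
    refine ae_iff.1 (ae_all_iff.2 fun s => ?_)
    by_cases hs : 1 ≤ s
    · filter_upwards [abs_noiseMean_le h hd hs] with ω hω _ using hω
    · exact ae_of_all _ fun ω hs' => absurd hs' hs
  have hsub : {ω | ¬ ((∀ s, 1 ≤ s → |noiseMean μ ε d s ω| ≤ φ d) ∧
      ∀ i ∈ Finset.Icc 1 d, ∀ k ≤ T, blockMixture Q d (fun s => X s ω)
        (fun s => ε s ω - noiseMean μ ε d s ω) i k < a)}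
      ⊆ {ω | ¬ ∀ s, 1 ≤ s → |noiseMean μ ε d s ω| ≤ φ d} ∪ ⋃ i ∈ Finset.Icc 1 d, bad i := by
    intro ω hω
    by_cases h1 : ∀ s, 1 ≤ s → |noiseMean μ ε d s ω| ≤ φ d
    · right
      have h2 : ¬ _ := fun h3 => hω ⟨h1, h3⟩
      push Not at h2
      obtain ⟨i, hi, k, hk, hik⟩ := h2
      simp only [Set.mem_iUnion]
      exact ⟨i, hi, k, hk, hik⟩
    · left
      exact h1
  calc _ ≤ _ := measure_mono hsub
    _ ≤ 0 + ∑ i ∈ Finset.Icc 1 d, μ (bad i) := by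
        refine (measure_union_le _ _).trans ?_
        rw [hnull]
        gcongr
        exact measure_biUnion_finset_le _ _
    _ ≤ 0 + ∑ i ∈ Finset.Icc 1 d, a⁻¹ := by
        gcongr with i hi
        have := measure_blockMixture_ge h hd hX Q (Finset.mem_Icc.1 hi).1 a T
        rw [← one_div, ENNReal.le_div_iff_mul_le (Or.inl ha0) (Or.inl hat), mul_comm]
        exact this
    _ = ENNReal.ofReal δ := by
        rw [zero_add, Finset.sum_const, Nat.card_Icc, nsmul_eq_mul, Nat.add_sub_cancel, ha,
          ← ENNReal.ofReal_inv_of_pos (by positivity), ← ENNReal.ofReal_natCast,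
          ← ENNReal.ofReal_mul hd0.le]
        congr 1
        field_simp

end Noise

/-! ### The confidence sets contain the true parameter -/

/-- Splitting a sum over rounds into residue classes. -/
theorem sum_Icc_eq_sum_blocks {M : Type*} [AddCommMonoid M] {d : ℕ} (hd : 1 ≤ d) (t : ℕ)
    (f : ℕ → M) :
    ∑ s ∈ Finset.Icc 1 t, f s
      = ∑ i ∈ Finset.Icc 1 d, ∑ k ∈ Finset.range ((t + d - i) / d), f (i + k * d) := by
  rw [Finset.sum_sigma']
  -- Rounds start at `1`, hence the shift by one. Class `i` has `(t - i) / d + 1` rounds up to `t`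
  -- when `i ≤ t`; the form `(t + d - i) / d` also gives `0` when `t < i ≤ d`.
  refine Finset.sum_nbij' (fun s => (⟨(s - 1) % d + 1, (s - 1) / d⟩ : Σ _ : ℕ, ℕ))
    (fun z => z.1 + z.2 * d) ?_ ?_ ?_ ?_ ?_
  · intro s hs
    have hs' := Finset.mem_Icc.1 hs
    have h1 := Nat.mod_lt (s - 1) hd
    have h2 := Nat.div_add_mod (s - 1) d
    simp only [Finset.mem_sigma, Finset.mem_Icc, Finset.mem_range]
    refine ⟨⟨by omega, by omega⟩, ?_⟩
    rw [Nat.lt_iff_add_one_le, Nat.le_div_iff_mul_le hd, add_mul, mul_comm, one_mul]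
    omega
  · intro z hz
    simp only [Finset.mem_sigma, Finset.mem_Icc, Finset.mem_range] at hz
    obtain ⟨⟨h1, h2⟩, h3⟩ := hz
    rw [Nat.lt_iff_add_one_le, Nat.le_div_iff_mul_le hd, add_mul, one_mul] at h3
    exact Finset.mem_Icc.2 ⟨by omega, by omega⟩
  · intro s hs
    have hs' := Finset.mem_Icc.1 hs
    have h2 := Nat.div_add_mod (s - 1) d
    rw [mul_comm] at h2
    simp only
    omega
  · intro z hz
    simp only [Finset.mem_sigma, Finset.mem_Icc, Finset.mem_range] at hz
    obtain ⟨⟨h1, h2⟩, -⟩ := hz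
    obtain ⟨i, k⟩ := z
    simp only at h1 h2 ⊢
    have h4 : i + k * d - 1 = (i - 1) + d * k := by rw [mul_comm]; omega
    rw [h4, Nat.add_mul_mod_self_left, Nat.add_mul_div_left _ _ hd, Nat.mod_eq_of_lt (by omega),
      Nat.div_eq_of_lt (by omega), Nat.sub_add_cancel h1, zero_add]
  · intro s hs
    have hs' := Finset.mem_Icc.1 hs
    have h2 := Nat.div_add_mod (s - 1) d
    rw [mul_comm] at h2
    simp only
    congr 1
    omega

theorem dotProduct_vecMulVec_mulVec {p : ℕ} (x u : Vec p) :
    u.ofLp ⬝ᵥ ((Matrix.vecMulVec x.ofLp x.ofLp).mulVec u.ofLp) = inner ℝ u x ^ 2 := by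
  rw [Matrix.vecMulVec_mulVec, EuclideanSpace.inner_eq_star_dotProduct]
  simp [dotProduct_comm, pow_two]

theorem weightedNormSq_featureCov {p : ℕ} (lam : ℝ) (x : ℕ → Vec p) (t : ℕ) (u : Vec p) :
    weightedNormSq (featureCov lam x t) u
      = ∑ s ∈ Finset.Icc 1 t, inner ℝ u (x s) ^ 2 + lam * ‖u‖ ^ 2 := by
  rw [weightedNormSq, featureCov, Matrix.add_mulVec, dotProduct_add, Matrix.sum_mulVec,
    dotProduct_sum]
  congr 1
  · exact Finset.sum_congr rfl fun s _ => dotProduct_vecMulVec_mulVec _ _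
  · rw [Matrix.smul_mulVec, Matrix.one_mulVec, dotProduct_smul, smul_eq_mul,
      EuclideanSpace.real_norm_sq_eq]
    simp [dotProduct, pow_two]

/-- First-order optimality of the constrained least-squares estimate. -/
theorem sum_sq_le_of_isMinOn {p : ℕ} {B : ℝ} {x : ℕ → Vec p} {ε : ℕ → ℝ} {t : ℕ}
    {θstar θhat : Vec p} (hθ : θstar ∈ Metric.closedBall (0 : Vec p) B)
    (hmem : θhat ∈ Metric.closedBall (0 : Vec p) B)
    (hmin : IsMinOn (sqLoss x (fun s => inner ℝ θstar (x s) + ε s) t)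
      (Metric.closedBall (0 : Vec p) B) θhat) :
    ∑ s ∈ Finset.Icc 1 t, inner ℝ (θhat - θstar) (x s) ^ 2
      ≤ ∑ s ∈ Finset.Icc 1 t, ε s * inner ℝ (θhat - θstar) (x s) := by
  set b : ℕ → ℝ := fun s => inner ℝ (θhat - θstar) (x s) with hb
  -- Compares `θhat` with the point a fraction `r` of the way to `θstar`, which stays in the ball by
  -- convexity.
  have key : ∀ r : ℝ, 0 < r → r ≤ 1 →
      2 * ∑ s ∈ Finset.Icc 1 t, (b s - ε s) * b s ≤ r * ∑ s ∈ Finset.Icc 1 t, b s ^ 2 := by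
    intro r hr0 hr1
    have hm : (1 - r) • θhat + r • θstar ∈ Metric.closedBall (0 : Vec p) B :=
      convex_closedBall _ _ hmem hθ (by linarith) hr0.le (by ring)
    have h1 := isMinOn_iff.1 hmin _ hm
    unfold sqLoss at h1
    have h2 : ∀ s, inner ℝ ((1 - r) • θhat + r • θstar) (x s) - (inner ℝ θstar (x s) + ε s)
        = (b s - ε s) - r * b s := by
      intro s
      simp only [hb, inner_add_left, real_inner_smul_left, inner_sub_left]
      ring
    have h3 : ∀ s, inner ℝ θhat (x s) - (inner ℝ θstar (x s) + ε s) = b s - ε s := by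
      intro s
      simp only [hb, inner_sub_left]
      ring
    simp_rw [h2, h3] at h1
    have h4 : ∑ s ∈ Finset.Icc 1 t, ((b s - ε s) - r * b s) ^ 2
        = ∑ s ∈ Finset.Icc 1 t, (b s - ε s) ^ 2
          - r * (2 * ∑ s ∈ Finset.Icc 1 t, (b s - ε s) * b s)
          + r * (r * ∑ s ∈ Finset.Icc 1 t, b s ^ 2) := by
      simp only [Finset.mul_sum]
      rw [← Finset.sum_sub_distrib, ← Finset.sum_add_distrib]
      exact Finset.sum_congr rfl fun s _ => by ring
    rw [h4] at h1
    refine le_of_mul_le_mul_left ?_ hr0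
    linarith
  have hS : 0 ≤ ∑ s ∈ Finset.Icc 1 t, b s ^ 2 := Finset.sum_nonneg fun s _ => sq_nonneg _
  have h5 : ∑ s ∈ Finset.Icc 1 t, (b s - ε s) * b s ≤ 0 := by
    by_contra! hcon
    set A := ∑ s ∈ Finset.Icc 1 t, (b s - ε s) * b s
    set S := ∑ s ∈ Finset.Icc 1 t, b s ^ 2
    -- This step size makes `r * S ≤ A`, so `2 * A ≤ A` contradicts `0 < A`.
    have h6 := key (min 1 (A / (S + 1))) (lt_min one_pos (by positivity)) (min_le_left _ _)
    have h7 : min 1 (A / (S + 1)) * S ≤ A := by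
      calc min 1 (A / (S + 1)) * S ≤ A / (S + 1) * (S + 1) := by
            gcongr
            · exact min_le_right _ _
            · linarith
        _ = A := by field_simp
    linarith
  have h8 : ∑ s ∈ Finset.Icc 1 t, (b s - ε s) * b s
      = ∑ s ∈ Finset.Icc 1 t, b s ^ 2 - ∑ s ∈ Finset.Icc 1 t, ε s * b s := by
    rw [← Finset.sum_sub_distrib]
    exact Finset.sum_congr rfl fun s _ => by ring
  linarith

/-- The stochastic part of the confidence radius. -/
def logRadius (p d : ℕ) (B δ : ℝ) (t : ℕ) : ℝ :=
  (d : ℝ) * p / 2 *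
      Real.log ((B + 1) ^ 2 * Real.exp 1 * max ((d : ℝ) * p) ((t : ℝ) + d) / ((d : ℝ) * p))
    + d * Real.log (d / δ)

/-- The uniform prior on the ball of radius `B + 1` around `-θstar`. -/
def shiftedPrior {p : ℕ} (B : ℝ) (θstar : Vec p) : Measure (Vec p) :=
  ProbabilityTheory.cond volume (Metric.closedBall (-θstar) (B + 1))

theorem isProbabilityMeasure_shiftedPrior {p : ℕ} {B : ℝ} (hB : 0 < B) (θstar : Vec p) :
    IsProbabilityMeasure (shiftedPrior B θstar) :=
  ProbabilityTheory.cond_isProbabilityMeasure_of_finite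
    (Metric.measure_closedBall_pos _ _ (by positivity)).ne' measure_closedBall_lt_top.ne

/-- The small ball around `θhat - θstar` has radius `c ≤ 1`, so it lies in the support of the prior,
whose deterministic centre is `-θstar`. The choice `c² = d p / m` gives `n c² ≤ p`, so the Jensen
error is at most `p * ballMoment p / 2`. The radius budgets `p / 2` for it through the factor `e` in
its logarithm; the difference is the slack. -/
theorem logRatio_block_le {p d t n : ℕ} {B δ : ℝ} (hp : 1 ≤ p) (hd : 1 ≤ d) (hB : 0 < B)
    (hδ : 0 < δ) {x : ℕ → Vec p} {η : ℕ → ℝ} (hx : ∀ k < n, ‖x k‖ ≤ 1) {θstar θhat : Vec p}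
    (hmem : θhat ∈ Metric.closedBall (0 : Vec p) B) (hn : (n : ℝ) * d ≤ t + d)
    (hlt : ∫⁻ v, ENNReal.ofReal (Real.exp (logRatio x η n v)) ∂(shiftedPrior B θstar)
      < ENNReal.ofReal (d / δ)) :
    d * logRatio x η n (θhat - θstar)
      ≤ logRadius p d B δ t - d * p * (1 - ballMoment p) / 2 := by
  have hd0 : (1 : ℝ) ≤ d := by exact_mod_cast hd
  have hp0 : (1 : ℝ) ≤ p := by exact_mod_cast hp
  have hdp : 0 < (d : ℝ) * p := by positivity
  set m := max ((d : ℝ) * p) ((t : ℝ) + d) with hm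
  have hm0 : 0 < m := lt_of_lt_of_le hdp (le_max_left _ _)
  set c := √(d * p / m) with hc
  have hc0 : 0 < c := by positivity
  have hc2 : c ^ 2 = d * p / m := Real.sq_sqrt (by positivity)
  have hc1 : c ≤ 1 := by
    rw [hc, Real.sqrt_le_one, div_le_one hm0]
    exact le_max_left _ _
  have hsub : Metric.closedBall (θhat - θstar) c ⊆ Metric.closedBall (-θstar) (B + 1) := by
    refine Metric.closedBall_subset_closedBall' ?_
    have h1 : dist (θhat - θstar) (-θstar) = ‖θhat‖ := by
      rw [dist_eq_norm]
      congr 1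
      abel
    have h2 : ‖θhat‖ ≤ B := by simpa using hmem
    rw [h1]
    linarith
  have key := logRatio_le_of_mixture_lt hx (by positivity) hc0 (by positivity) hsub hlt
  have h1 : (p : ℝ) * Real.log ((B + 1) / c) + p / 2
      = p / 2 * Real.log ((B + 1) ^ 2 * Real.exp 1 * m / (d * p)) := by
    have h2 : (B + 1) ^ 2 * Real.exp 1 * m / (d * p) = ((B + 1) / c) ^ 2 * Real.exp 1 := by
      rw [div_pow, hc2]
      field_simp
    rw [h2, Real.log_mul (by positivity) (by positivity), Real.log_exp, Real.log_pow]
    push_cast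
    ring
  have h3 : (n : ℝ) * c ^ 2 ≤ p := by
    rw [hc2, ← mul_div_assoc, div_le_iff₀ hm0]
    have h4 : (t : ℝ) + d ≤ m := le_max_right _ _
    nlinarith
  have h5 := ballMoment_nonneg p
  have h6 : (n : ℝ) / 2 * (c ^ 2 * ballMoment p) ≤ p / 2 * ballMoment p := by
    have := mul_le_mul_of_nonneg_right h3 h5
    linarith
  have h7 : logRatio x η n (θhat - θstar) ≤ Real.log (d / δ)
      + p / 2 * Real.log ((B + 1) ^ 2 * Real.exp 1 * m / (d * p))
      - p * (1 - ballMoment p) / 2 := by linarith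
  have h8 := mul_le_mul_of_nonneg_left h7 (by positivity : (0 : ℝ) ≤ d)
  rw [logRadius]
  refine h8.trans (le_of_eq ?_)
  ring

theorem logRadius_ge {p d t : ℕ} {B δ : ℝ} (hp : 1 ≤ p) (hd : 1 ≤ d) (hB : 0 < B)
    (hδ : 0 < δ) (hδ1 : δ < 1) : (d : ℝ) * p / 2 ≤ logRadius p d B δ t := by
  have hd0 : (1 : ℝ) ≤ d := by exact_mod_cast hd
  have hp0 : (1 : ℝ) ≤ p := by exact_mod_cast hp
  have hdp : 0 < (d : ℝ) * p := by positivity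
  have h1 : 0 ≤ Real.log (d / δ) := Real.log_nonneg (by rw [le_div_iff₀ hδ]; linarith)
  have h2 : 1 ≤ Real.log ((B + 1) ^ 2 * Real.exp 1 * max ((d : ℝ) * p) ((t : ℝ) + d)
      / ((d : ℝ) * p)) := by
    rw [Real.le_log_iff_exp_le (by positivity), le_div_iff₀ hdp]
    have h3 : 1 ≤ (B + 1) ^ 2 := by nlinarith
    have h4 : (d : ℝ) * p ≤ max ((d : ℝ) * p) ((t : ℝ) + d) := le_max_left _ _
    calc Real.exp 1 * (d * p) = 1 * Real.exp 1 * (d * p) := by ring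
      _ ≤ _ := by gcongr
  have h5 := mul_le_mul_of_nonneg_left h2 (by positivity : 0 ≤ (d : ℝ) * p / 2)
  have h6 := mul_nonneg (by positivity : (0 : ℝ) ≤ d) h1
  rw [logRadius]
  linarith

/-- The bound is `d` times a quantity free of `d`. Since the slack also scales with `d`, the
threshold on `T` can be chosen independently of the delay, hence of `C` and `τ`. -/
theorem logRadius_le {p d t T : ℕ} {B δ : ℝ} (hp : 1 ≤ p) (hd : 1 ≤ d) (hB : 0 < B)
    (hδ : 0 < δ) (htT : t + d ≤ T) :
    logRadius p d B δ t
      ≤ d * (p / 2 * Real.log ((B + 1) ^ 2 * Real.exp 1 * T) + Real.log (T / δ)) := by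
  have hd0 : (1 : ℝ) ≤ d := by exact_mod_cast hd
  have hp0 : (1 : ℝ) ≤ p := by exact_mod_cast hp
  have htT' : (t : ℝ) + d ≤ T := by exact_mod_cast htT
  have ht0 : (0 : ℝ) ≤ t := t.cast_nonneg
  have hdp : 1 ≤ (d : ℝ) * p := one_le_mul_of_one_le_of_one_le hd0 hp0
  have h1 : max ((d : ℝ) * p) ((t : ℝ) + d) ≤ T * (d * p) :=
    max_le (le_mul_of_one_le_left (by positivity) (by linarith))
      (htT'.trans (le_mul_of_one_le_right (by linarith) hdp))
  have h2 : Real.log ((B + 1) ^ 2 * Real.exp 1 * max ((d : ℝ) * p) ((t : ℝ) + d)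
      / ((d : ℝ) * p)) ≤ Real.log ((B + 1) ^ 2 * Real.exp 1 * T) := by
    refine Real.log_le_log (by positivity) ?_
    rw [div_le_iff₀ (by positivity), mul_assoc ((B + 1) ^ 2 * Real.exp 1)]
    gcongr
  have h3 : Real.log (d / δ) ≤ Real.log (T / δ) := by
    refine Real.log_le_log (by positivity) ?_
    gcongr
    linarith
  rw [logRadius]
  calc _ ≤ (d : ℝ) * p / 2 * Real.log ((B + 1) ^ 2 * Real.exp 1 * T)
        + d * Real.log (T / δ) := by gcongr
    _ = _ := by ring

/-- The function `w ↦ w² / 2 - a w` increases beyond `a`. At `w = √(2 * R)` it is already at least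
`R - s`, so `√W` cannot be larger. -/
theorem half_le_of_le_add_sqrt {W R a s : ℝ} (hW : 0 ≤ W) (hR : 0 ≤ R)
    (h : W / 2 ≤ R - s + a * √W) (har : a ≤ √(2 * R)) (has : a * √(2 * R) ≤ s) : W / 2 ≤ R := by
  by_contra! hcon
  have hr2 : √(2 * R) ^ 2 = 2 * R := Real.sq_sqrt (by linarith)
  have hw2 : √W ^ 2 = W := Real.sq_sqrt hW
  have hw : √(2 * R) < √W := Real.sqrt_lt_sqrt (by linarith) (by linarith)
  have := mul_pos (sub_pos.2 hw) (by linarith : 0 < √W + √(2 * R) - 2 * a)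
  linarith

/-- The least-squares error in terms of the stochastic radius and of the drift of the noise. -/
theorem half_sum_sq_le {p d t T : ℕ} {B δ : ℝ} (hp : 1 ≤ p) (hd : 1 ≤ d) (hB : 0 < B)
    (hδ : 0 < δ) {φ : ℝ} {x : ℕ → Vec p} {ε m : ℕ → ℝ}
    {θstar θhat : Vec p} (hx : ∀ s, 1 ≤ s → ‖x s‖ ≤ 1)
    (hθ : θstar ∈ Metric.closedBall (0 : Vec p) B)
    (hmem : θhat ∈ Metric.closedBall (0 : Vec p) B)
    (hmin : IsMinOn (sqLoss x (fun s => inner ℝ θstar (x s) + ε s) t)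
      (Metric.closedBall (0 : Vec p) B) θhat)
    (hm : ∀ s, 1 ≤ s → |m s| ≤ φ)
    (hmix : ∀ i ∈ Finset.Icc 1 d, ∀ k ≤ T, blockMixture (shiftedPrior B θstar) d x
      (fun s => ε s - m s) i k < ENNReal.ofReal (d / δ))
    (htT : t + d ≤ T) (hφ0 : 0 ≤ φ) :
    (∑ s ∈ Finset.Icc 1 t, inner ℝ (θhat - θstar) (x s) ^ 2) / 2
      ≤ logRadius p d B δ t - d * p * (1 - ballMoment p) / 2
        + φ * √t * √(∑ s ∈ Finset.Icc 1 t, inner ℝ (θhat - θstar) (x s) ^ 2) := by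
  have hd0 : (1 : ℝ) ≤ d := by exact_mod_cast hd
  set u := θhat - θstar with hu
  set W := ∑ s ∈ Finset.Icc 1 t, inner ℝ u (x s) ^ 2 with hW
  set R := logRadius p d B δ t with hR
  set κ := 1 - ballMoment p with hκd
  have hblock : ∑ s ∈ Finset.Icc 1 t,
      (inner ℝ u (x s) * (ε s - m s) - inner ℝ u (x s) ^ 2 / 2) ≤ R - d * p * κ / 2 := by
    rw [sum_Icc_eq_sum_blocks hd]
    have h1 : ∀ i ∈ Finset.Icc 1 d, ∑ k ∈ Finset.range ((t + d - i) / d),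
        (inner ℝ u (x (i + k * d)) * (ε (i + k * d) - m (i + k * d))
          - inner ℝ u (x (i + k * d)) ^ 2 / 2) ≤ (R - d * p * κ / 2) / d := by
      intro i hi
      have hi' := Finset.mem_Icc.1 hi
      rw [le_div_iff₀ (by linarith), mul_comm]
      have hn : (t + d - i) / d * d ≤ t + d :=
        (Nat.div_mul_le_self _ _).trans (Nat.sub_le _ _)
      have hnT : (t + d - i) / d ≤ T :=
        (Nat.div_le_self _ _).trans ((Nat.sub_le _ _).trans htT)
      exact logRatio_block_le (x := fun k => x (i + k * d))
        (η := fun k => ε (i + k * d) - m (i + k * d)) hp hd hB hδ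
        (fun k _ => hx _ (by omega)) hmem (by exact_mod_cast hn) (hmix i hi _ hnT)
    refine (Finset.sum_le_sum h1).trans (le_of_eq ?_)
    rw [Finset.sum_const, Nat.card_Icc, nsmul_eq_mul, Nat.add_sub_cancel]
    field_simp
  have hdrift : ∑ s ∈ Finset.Icc 1 t, m s * inner ℝ u (x s) ≤ φ * √t * √W := by
    calc ∑ s ∈ Finset.Icc 1 t, m s * inner ℝ u (x s)
        ≤ ∑ s ∈ Finset.Icc 1 t, φ * |inner ℝ u (x s)| := by
          refine Finset.sum_le_sum fun s hs => (le_abs_self _).trans ?_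
          rw [abs_mul]
          gcongr
          exact hm s (Finset.mem_Icc.1 hs).1
      _ = φ * ∑ s ∈ Finset.Icc 1 t, 1 * |inner ℝ u (x s)| := by simp [Finset.mul_sum]
      _ ≤ φ * (√(∑ s ∈ Finset.Icc 1 t, (1 : ℝ) ^ 2)
            * √(∑ s ∈ Finset.Icc 1 t, |inner ℝ u (x s)| ^ 2)) := by
          gcongr
          exact Real.sum_mul_le_sqrt_mul_sqrt _ _ _
      _ = φ * √t * √W := by simp [hW, mul_assoc]
  have hLS := sum_sq_le_of_isMinOn hθ hmem hmin
  rw [← hu] at hLS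
  -- Adding and subtracting half of each square produces the exponent of the likelihood ratio and
  -- leaves `W / 2` to be absorbed on the left.
  have h1 : ∑ s ∈ Finset.Icc 1 t, ε s * inner ℝ u (x s)
      = ∑ s ∈ Finset.Icc 1 t,
        (inner ℝ u (x s) * (ε s - m s) - inner ℝ u (x s) ^ 2 / 2)
        + ∑ s ∈ Finset.Icc 1 t, m s * inner ℝ u (x s) + W / 2 := by
    rw [hW, Finset.sum_div, ← Finset.sum_add_distrib, ← Finset.sum_add_distrib]
    exact Finset.sum_congr rfl fun s _ => by ring
  linarith

/-- From `φ ≤ p / (B T)` the drift coefficient satisfies `φ √t ≤ p / (B √T)`. The two conclusions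
are what `half_le_of_le_add_sqrt` asks for, with the slack as `s`. -/
theorem drift_le {p d t T : ℕ} {B κ R ρ φ : ℝ} (hp : 1 ≤ p) (hd : 1 ≤ d) (hB : 0 < B)
    (hκ : 0 < κ) (htT : t ≤ T) (hT : 1 ≤ T) (hφ0 : 0 ≤ φ) (hφ : φ * (B * T) ≤ p)
    (hT1 : (p : ℝ) ^ 2 ≤ B ^ 2 * T) (hR : (d : ℝ) * p / 2 ≤ R) (hRρ : R ≤ d * ρ)
    (hρ : 8 * ρ ≤ κ ^ 2 * (B ^ 2 * T)) :
    φ * √t ≤ √(2 * R) ∧ φ * √t * √(2 * R) ≤ d * p * κ / 2 := by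
  have hd0 : (1 : ℝ) ≤ d := by exact_mod_cast hd
  have hp0 : (1 : ℝ) ≤ p := by exact_mod_cast hp
  have htT' : (t : ℝ) ≤ T := by exact_mod_cast htT
  have ht0 : (0 : ℝ) ≤ t := t.cast_nonneg
  have hT0 : (0 : ℝ) < T := by exact_mod_cast hT
  have hdp : 1 ≤ (d : ℝ) * p := one_le_mul_of_one_le_of_one_le hd0 hp0
  set a := φ * √t with ha
  have ha0 : 0 ≤ a := by positivity
  have ha2 : a ^ 2 * (B ^ 2 * T) ≤ p ^ 2 := by
    rw [ha, mul_pow, Real.sq_sqrt ht0]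
    have h1 : (φ * (B * T)) ^ 2 ≤ p ^ 2 := by gcongr
    have h2 : φ ^ 2 * t * (B ^ 2 * T) ≤ φ ^ 2 * T * (B ^ 2 * T) := by
      gcongr
    calc φ ^ 2 * t * (B ^ 2 * T) ≤ φ ^ 2 * T * (B ^ 2 * T) := h2
      _ = (φ * (B * T)) ^ 2 := by ring
      _ ≤ p ^ 2 := h1
  set r := √(2 * R) with hr
  have hr2 : r ^ 2 = 2 * R := Real.sq_sqrt (by linarith)
  have hr0 : 0 ≤ r := Real.sqrt_nonneg _
  constructor
  · refine abs_le_of_sq_le_sq' ?_ hr0 |>.2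
    have h1 : a ^ 2 ≤ 1 := by
      have h2 : a ^ 2 * p ^ 2 ≤ 1 * p ^ 2 := by
        rw [one_mul]
        exact (mul_le_mul_of_nonneg_left hT1 (sq_nonneg a)).trans ha2
      exact le_of_mul_le_mul_right h2 (by positivity)
    linarith
  · refine abs_le_of_sq_le_sq' ?_ (by positivity) |>.2
    have hBT : 0 < B ^ 2 * T := by positivity
    refine le_of_mul_le_mul_right ?_ hBT
    rw [mul_pow, hr2]
    have h1 : a ^ 2 * (2 * R) * (B ^ 2 * T) ≤ p ^ 2 * (2 * R) := by
      have h2 : 0 ≤ 2 * R := by linarith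
      calc a ^ 2 * (2 * R) * (B ^ 2 * T) = a ^ 2 * (B ^ 2 * T) * (2 * R) := by ring
        _ ≤ p ^ 2 * (2 * R) := by gcongr
    have h3 : 8 * R ≤ d ^ 2 * (κ ^ 2 * (B ^ 2 * T)) := by
      calc 8 * R ≤ d * (8 * ρ) := by linarith
        _ ≤ d * (κ ^ 2 * (B ^ 2 * T)) := by gcongr
        _ ≤ d ^ 2 * (κ ^ 2 * (B ^ 2 * T)) := by
            gcongr
            nlinarith
    have h4 := mul_le_mul_of_nonneg_left h3 (by positivity : (0 : ℝ) ≤ p ^ 2)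
    calc a ^ 2 * (2 * R) * (B ^ 2 * T) ≤ p ^ 2 * (2 * R) := h1
      _ ≤ (d * p * κ / 2) ^ 2 * (B ^ 2 * T) := by linarith

theorem mem_confSet_of_mixture_lt {p d t T : ℕ} {B δ : ℝ} (hp : 1 ≤ p) (hd : 1 ≤ d) (hB : 0 < B)
    (hδ : 0 < δ) (hδ1 : δ < 1) {φ : ℕ → ℝ} {x : ℕ → Vec p} {ε m : ℕ → ℝ}
    {θstar θhat : Vec p} (hx : ∀ s, 1 ≤ s → ‖x s‖ ≤ 1)
    (hθ : θstar ∈ Metric.closedBall (0 : Vec p) B)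
    (hmem : θhat ∈ Metric.closedBall (0 : Vec p) B)
    (hmin : IsMinOn (sqLoss x (fun s => inner ℝ θstar (x s) + ε s) t)
      (Metric.closedBall (0 : Vec p) B) θhat)
    (hm : ∀ s, 1 ≤ s → |m s| ≤ φ d)
    (hmix : ∀ i ∈ Finset.Icc 1 d, ∀ k ≤ T, blockMixture (shiftedPrior B θstar) d x
      (fun s => ε s - m s) i k < ENNReal.ofReal (d / δ))
    (htT : t + d ≤ T) (hφ0 : 0 ≤ φ d) (hφ : φ d * (B * T) ≤ p) (hT1 : (p : ℝ) ^ 2 ≤ B ^ 2 * T)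
    (hT2 : 8 * (p / 2 * Real.log ((B + 1) ^ 2 * Real.exp 1 * T) + Real.log (T / δ))
      ≤ (1 - ballMoment p) ^ 2 * (B ^ 2 * T)) :
    θstar ∈ confSet d B (1 / B ^ 2) δ φ x θhat t := by
  have hd0 : (1 : ℝ) ≤ d := by exact_mod_cast hd
  have hp0 : (1 : ℝ) ≤ p := by exact_mod_cast hp
  have htT' : (t : ℝ) + d ≤ T := by exact_mod_cast htT
  have ht0 : (0 : ℝ) ≤ t := t.cast_nonneg
  have hT0 : (0 : ℝ) < T := by linarith
  have hdp : 1 ≤ (d : ℝ) * p := one_le_mul_of_one_le_of_one_le hd0 hp0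
  set u := θhat - θstar with hu
  set W := ∑ s ∈ Finset.Icc 1 t, inner ℝ u (x s) ^ 2 with hW
  set R := logRadius p d B δ t with hR
  have hW0 : 0 ≤ W := Finset.sum_nonneg fun _ _ => sq_nonneg _
  have hκ : 0 < 1 - ballMoment p := by linarith [ballMoment_lt_one p]
  set κ := 1 - ballMoment p with hκd
  have hRge : (d : ℝ) * p / 2 ≤ R := logRadius_ge hp hd hB hδ hδ1
  have hmain := half_sum_sq_le hp hd hB hδ hx hθ hmem hmin hm hmix htT hφ0
  obtain ⟨h1, h2⟩ := drift_le (t := t) (T := T) hp hd hB hκ (by omega) (by omega) hφ0 hφ hT1 hRge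
    (logRadius_le (B := B) hp hd hB hδ htT) hT2
  have hWR : W / 2 ≤ R := half_le_of_le_add_sqrt hW0 (by linarith) hmain h1 h2
  refine ⟨hθ, ?_⟩
  have hnorm : ‖θstar - θhat‖ ≤ 2 * B := by
    have h1 : ‖θstar‖ ≤ B := by simpa using hθ
    have h2 : ‖θhat‖ ≤ B := by simpa using hmem
    linarith [norm_sub_le θstar θhat]
  -- Half of this regularisation term uses up exactly the summand `2` of the radius.
  have hreg : 1 / B ^ 2 * ‖θstar - θhat‖ ^ 2 ≤ 4 := by
    rw [one_div, inv_mul_le_iff₀ (by positivity)]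
    have := norm_nonneg (θstar - θhat)
    nlinarith
  have hWeq : ∑ s ∈ Finset.Icc 1 t, inner ℝ (θstar - θhat) (x s) ^ 2 = W := by
    refine Finset.sum_congr rfl fun s _ => ?_
    rw [hu, ← neg_sub θstar θhat, inner_neg_left, neg_sq]
  rw [weightedNormSq_featureCov, hWeq]
  have hconf : confRadius p d B (1 / B ^ 2) δ φ t = R + 2 + t * φ d * (B + 1) := by
    rw [confRadius, hR, logRadius]
    have : 2 * (1 / B ^ 2) * B ^ 2 = 2 := by field_simp
    rw [this]
    ring
  rw [hconf]
  have : 0 ≤ t * φ d * (B + 1) := by positivity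
  linarith

/-! ### The elliptical potential -/

/-- Cauchy–Schwarz for the form of `A`, read off from the discriminant of `r ↦ ‖A⁻¹ a - r b‖²_A ≥
0`. -/
theorem sq_dotProduct_le_of_posDef {ι : Type*} [Fintype ι] [DecidableEq ι] {A : Matrix ι ι ℝ}
    (hA : A.PosDef) (a b : ι → ℝ) :
    (a ⬝ᵥ b) ^ 2 ≤ (a ⬝ᵥ A⁻¹.mulVec a) * (b ⬝ᵥ A.mulVec b) := by
  have hdet : IsUnit A.det := (Matrix.isUnit_iff_isUnit_det A).1 hA.isUnit
  set y := A⁻¹.mulVec a with hy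
  have hAy : A.mulVec y = a := by
    rw [hy, Matrix.mulVec_mulVec, Matrix.mul_nonsing_inv _ hdet, Matrix.one_mulVec]
  have hsymm : ∀ v w : ι → ℝ, v ⬝ᵥ A.mulVec w = w ⬝ᵥ A.mulVec v := by
    intro v w
    have hT : A.transpose = A := by simpa using hA.isHermitian.eq
    rw [Matrix.dotProduct_mulVec, ← Matrix.mulVec_transpose, hT, dotProduct_comm]
  have hq : ∀ r : ℝ, 0 ≤ (b ⬝ᵥ A.mulVec b) * (r * r) + (-2 * (a ⬝ᵥ b)) * r + a ⬝ᵥ y := by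
    intro r
    have h0 := hA.posSemidef.dotProduct_mulVec_nonneg (y - r • b)
    have h1 : y ⬝ᵥ A.mulVec y = a ⬝ᵥ y := by rw [hAy, dotProduct_comm]
    have h2 : b ⬝ᵥ A.mulVec y = a ⬝ᵥ b := by rw [hAy, dotProduct_comm]
    simp only [star_trivial, Matrix.mulVec_sub, Matrix.mulVec_smul, dotProduct_sub, sub_dotProduct,
      smul_dotProduct, dotProduct_smul, smul_eq_mul, hsymm y b, h1, h2] at h0
    linarith
  have := discrim_le_zero hq
  rw [discrim] at this
  linarith

/-- Each eigenvalue is at most the trace. The loss against the arithmetic–geometric mean inequality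
only enters inside a logarithm. -/
theorem det_le_trace_pow {ι : Type*} [Fintype ι] [DecidableEq ι] {A : Matrix ι ι ℝ}
    (hA : A.PosSemidef) : A.det ≤ A.trace ^ Fintype.card ι := by
  have hnn := hA.eigenvalues_nonneg
  have htr : A.trace = ∑ i, hA.isHermitian.eigenvalues i := by
    simpa using hA.isHermitian.trace_eq_sum_eigenvalues
  have hdet : A.det = ∏ i, hA.isHermitian.eigenvalues i := by
    simpa using hA.isHermitian.det_eq_prod_eigenvalues
  rw [hdet, htr, ← Finset.card_univ, ← Finset.prod_const]
  exact Finset.prod_le_prod (fun i _ => hnn i) fun i _ =>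
    Finset.single_le_sum (fun j _ => hnn j) (Finset.mem_univ i)

theorem det_add_vecMulVec {ι : Type*} [Fintype ι] [DecidableEq ι] {A : Matrix ι ι ℝ}
    (hA : IsUnit A.det) (a : ι → ℝ) :
    (A + Matrix.vecMulVec a a).det = A.det * (1 + a ⬝ᵥ A⁻¹.mulVec a) := by
  rw [Matrix.vecMulVec_eq Unit, Matrix.det_add_replicateCol_mul_replicateRow hA]
  congr 1
  rw [Matrix.det_unique, Matrix.add_apply, Matrix.mul_assoc]
  simp [Matrix.mul_apply, dotProduct, Matrix.mulVec]

/-- The regularised covariance of the first `n` vectors of a sequence numbered from `0`. -/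
def gram {p : ℕ} (lam : ℝ) (y : ℕ → Vec p) (n : ℕ) : Matrix (Fin p) (Fin p) ℝ :=
  ∑ k ∈ Finset.range n, Matrix.vecMulVec (y k).ofLp (y k).ofLp
    + lam • (1 : Matrix (Fin p) (Fin p) ℝ)

/-- The squared norm of the next vector in the inverse covariance. -/
def potential {p : ℕ} (lam : ℝ) (y : ℕ → Vec p) (n : ℕ) : ℝ :=
  (y n).ofLp ⬝ᵥ (gram lam y n)⁻¹.mulVec (y n).ofLp

theorem gram_posDef {p : ℕ} {lam : ℝ} (hlam : 0 < lam) (y : ℕ → Vec p) (n : ℕ) :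
    (gram lam y n).PosDef := by
  refine Matrix.PosDef.posSemidef_add ?_ (Matrix.PosDef.one.smul hlam)
  exact Matrix.posSemidef_sum _ fun k _ => Matrix.posSemidef_vecMulVec_self_star (y k).ofLp

theorem gram_succ {p : ℕ} (lam : ℝ) (y : ℕ → Vec p) (n : ℕ) :
    gram lam y (n + 1) = gram lam y n + Matrix.vecMulVec (y n).ofLp (y n).ofLp := by
  rw [gram, gram, Finset.sum_range_succ]
  abel

theorem weightedNormSq_gram {p : ℕ} (lam : ℝ) (y : ℕ → Vec p) (n : ℕ) (u : Vec p) :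
    weightedNormSq (gram lam y n) u
      = ∑ k ∈ Finset.range n, inner ℝ u (y k) ^ 2 + lam * ‖u‖ ^ 2 := by
  rw [weightedNormSq, gram, Matrix.add_mulVec, dotProduct_add, Matrix.sum_mulVec,
    dotProduct_sum]
  congr 1
  · exact Finset.sum_congr rfl fun s _ => dotProduct_vecMulVec_mulVec _ _
  · rw [Matrix.smul_mulVec, Matrix.one_mulVec, dotProduct_smul, smul_eq_mul,
      EuclideanSpace.real_norm_sq_eq]
    simp [dotProduct, pow_two]

theorem potential_nonneg {p : ℕ} {lam : ℝ} (hlam : 0 < lam) (y : ℕ → Vec p) (n : ℕ) :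
    0 ≤ potential lam y n := by
  simpa [potential] using (gram_posDef hlam y n).inv.posSemidef.dotProduct_mulVec_nonneg (y n).ofLp

theorem inner_le_sqrt_potential {p : ℕ} {lam : ℝ} (hlam : 0 < lam) (y : ℕ → Vec p) (n : ℕ)
    {u : Vec p} {b : ℝ} (hb : weightedNormSq (gram lam y n) u ≤ b) :
    inner ℝ (y n) u ≤ √b * √(potential lam y n) := by
  have h := sq_dotProduct_le_of_posDef (gram_posDef hlam y n) (y n).ofLp u.ofLp
  have hi : inner ℝ (y n) u = (y n).ofLp ⬝ᵥ u.ofLp := by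
    rw [EuclideanSpace.inner_eq_star_dotProduct]
    simp [dotProduct_comm]
  have hw := potential_nonneg hlam y n
  rw [← Real.sqrt_mul' _ hw, hi]
  refine Real.le_sqrt_of_sq_le (h.trans ?_)
  rw [mul_comm]
  exact mul_le_mul_of_nonneg_right hb hw

theorem trace_gram_le {p : ℕ} {lam : ℝ} {y : ℕ → Vec p} {n : ℕ} (hy : ∀ k < n, ‖y k‖ ≤ 1) :
    (gram lam y n).trace ≤ lam * p + n := by
  rw [gram, Matrix.trace_add, Matrix.trace_sum, Matrix.trace_smul, Matrix.trace_one,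
    Fintype.card_fin, smul_eq_mul, add_comm]
  gcongr
  calc ∑ k ∈ Finset.range n, (Matrix.vecMulVec (y k).ofLp (y k).ofLp).trace
      ≤ ∑ k ∈ Finset.range n, (1 : ℝ) := by
        refine Finset.sum_le_sum fun k hk => ?_
        have h1 : (Matrix.vecMulVec (y k).ofLp (y k).ofLp).trace = ‖y k‖ ^ 2 := by
          rw [Matrix.trace_vecMulVec, EuclideanSpace.real_norm_sq_eq]
          simp [dotProduct, pow_two]
        rw [h1]
        exact pow_le_one₀ (norm_nonneg _) (hy k (Finset.mem_range.1 hk))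
    _ = n := by simp

theorem min_one_le_two_mul_log {w : ℝ} (hw : 0 ≤ w) : min 1 w ≤ 2 * Real.log (1 + w) := by
  have h1 := Real.one_sub_inv_le_log_of_pos (by linarith : 0 < 1 + w)
  have h2 : 1 - (1 + w)⁻¹ = w / (1 + w) := by field_simp; ring
  -- The elementary bound `log (1 + w) ≥ w / (1 + w)` suffices here.
  have h3 : min 1 w / 2 ≤ w / (1 + w) := by
    rw [div_le_div_iff₀ two_pos (by linarith)]
    rcases le_total 1 w with h | h
    · rw [min_eq_left h]
      linarith
    · rw [min_eq_right h]
      nlinarith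
  linarith

/-- The elliptical potential lemma. -/
theorem sum_min_potential_le {p : ℕ} {lam : ℝ} (hlam : 0 < lam) {y : ℕ → Vec p} {n : ℕ}
    (hy : ∀ k < n, ‖y k‖ ≤ 1) :
    ∑ k ∈ Finset.range n, min 1 (potential lam y k)
      ≤ 2 * p * Real.log (p + n / lam) := by
  have hdet : ∀ k, 0 < (gram lam y k).det := fun k => (gram_posDef hlam y k).det_pos
  have h1 : ∀ k, Real.log (1 + potential lam y k)
      = Real.log (gram lam y (k + 1)).det - Real.log (gram lam y k).det := by
    intro k
    have hw := potential_nonneg hlam y k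
    rw [gram_succ, det_add_vecMulVec (hdet k).ne'.isUnit, Real.log_mul (hdet k).ne' ?_]
    · rw [potential]; ring
    · rw [potential] at hw
      linarith
  have h0 : (gram lam y 0).det = lam ^ p := by simp [gram]
  have h2 : (gram lam y n).det / lam ^ p ≤ (p + n / lam) ^ p := by
    rw [div_le_iff₀ (by positivity), ← mul_pow]
    refine (det_le_trace_pow (gram_posDef hlam y n).posSemidef).trans ?_
    rw [Fintype.card_fin]
    have h3 : (p + n / lam) * lam = lam * p + n := by field_simp
    rw [h3]
    have h4 : 0 ≤ (gram lam y n).trace := (gram_posDef hlam y n).posSemidef.trace_nonneg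
    have := trace_gram_le (lam := lam) hy
    gcongr
  calc ∑ k ∈ Finset.range n, min 1 (potential lam y k)
      ≤ ∑ k ∈ Finset.range n, 2 * Real.log (1 + potential lam y k) :=
        Finset.sum_le_sum fun k _ => min_one_le_two_mul_log (potential_nonneg hlam y k)
    _ = 2 * (Real.log (gram lam y n).det - Real.log (gram lam y 0).det) := by
        rw [← Finset.mul_sum, ← Finset.sum_range_sub (fun k => Real.log (gram lam y k).det)]
        simp_rw [h1]
    _ = 2 * Real.log ((gram lam y n).det / lam ^ p) := by
        rw [h0, Real.log_div (hdet n).ne' (by positivity)]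
    _ ≤ 2 * Real.log ((p + n / lam) ^ p) := by
        have := Real.log_le_log (div_pos (hdet n) (by positivity)) h2
        linarith
    _ = 2 * p * Real.log (p + n / lam) := by rw [Real.log_pow]; ring

/-! ### The regret -/

/-- Optimism: every arm satisfies `⟨y, θstar⟩ ≤ ucb S y ≤ ucb S x`, so the regret is at most the
width of `S` in the direction that was played. -/
theorem iSup_inner_sub_le {p : ℕ} {B D : ℝ} {S A : Set (Vec p)} {θstar x : Vec p}
    (hS : S ⊆ Metric.closedBall 0 B) (hθ : θstar ∈ S) (hx : x ∈ A) (hmax : IsMaxOn (ucb S) A x)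
    (hD : ∀ θ ∈ S, inner ℝ x (θ - θstar) ≤ D) :
    ⨆ y : A, (inner ℝ (y : Vec p) θstar - inner ℝ x θstar) ≤ D := by
  have : Nonempty A := ⟨⟨x, hx⟩⟩
  refine ciSup_le fun y => ?_
  -- Without boundedness the real supremum in `ucb` would take its default value `0`.
  have hbdd : BddAbove ((fun θ : Vec p => inner ℝ (y : Vec p) θ) '' S) := by
    refine ⟨‖(y : Vec p)‖ * B, ?_⟩
    rintro _ ⟨θ, hθS, rfl⟩
    have h1 : ‖θ‖ ≤ B := by simpa using hS hθS
    exact (real_inner_le_norm _ _).trans (by gcongr)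
  have h1 : inner ℝ (y : Vec p) θstar ≤ ucb S y := le_csSup hbdd ⟨θstar, hθ, rfl⟩
  have h2 : ucb S y ≤ ucb S x := hmax y.2
  have h3 : ucb S x ≤ inner ℝ x θstar + D := by
    refine csSup_le ⟨_, θstar, hθ, rfl⟩ ?_
    rintro _ ⟨θ, hθS, rfl⟩
    have := hD θ hθS
    rw [inner_sub_right] at this
    simp only
    linarith
  linarith

theorem iSup_inner_sub_le_two_mul {p : ℕ} {B : ℝ} {A : Set (Vec p)} {θstar x : Vec p}
    (hA : A ⊆ Metric.closedBall 0 1) (hθ : ‖θstar‖ ≤ B) (hx : x ∈ A) :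
    ⨆ y : A, (inner ℝ (y : Vec p) θstar - inner ℝ x θstar) ≤ 2 * B := by
  have : Nonempty A := ⟨⟨x, hx⟩⟩
  have habs : ∀ z ∈ A, |inner ℝ z θstar| ≤ B := by
    intro z hz
    have h1 : ‖z‖ ≤ 1 := by simpa using hA hz
    refine (abs_real_inner_le_norm _ _).trans ?_
    nlinarith [norm_nonneg θstar]
  refine ciSup_le fun y => ?_
  have h1 := abs_le.1 (habs y y.2)
  have h2 := abs_le.1 (habs x hx)
  linarith

/-- The rounds up to `i + k * d - d` include the first `k` rounds of class `i`; the other classes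
only add squares. -/
theorem weightedNormSq_gram_block_le {p d : ℕ} (hd : 1 ≤ d) (lam : ℝ) (x : ℕ → Vec p) {i k : ℕ}
    (hi : i ∈ Finset.Icc 1 d) (hk : 1 ≤ k) (u : Vec p) :
    weightedNormSq (gram lam (fun j => x (i + j * d)) k) u
      ≤ weightedNormSq (featureCov lam x (i + k * d - d)) u := by
  rw [weightedNormSq_gram, weightedNormSq_featureCov, sum_Icc_eq_sum_blocks hd]
  gcongr
  have hkd : d ≤ k * d := Nat.le_mul_of_pos_left d hk
  have h1 : (i + k * d - d + d - i) / d = k := by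
    rw [Nat.sub_add_cancel (by omega), Nat.add_sub_cancel_left, Nat.mul_div_cancel _ hd]
  have h2 := Finset.single_le_sum (s := Finset.Icc 1 d)
    (f := fun i' => ∑ j ∈ Finset.range ((i + k * d - d + d - i') / d),
      (inner ℝ u (x (i' + j * d)) : ℝ) ^ 2)
    (fun i' _ => Finset.sum_nonneg fun _ _ => sq_nonneg _) hi
  simp only [h1] at h2
  exact h2

section Regret

variable {Ω : Type*} {p d T : ℕ} {B δ β : ℝ} {φ : ℕ → ℝ} {ε : ℕ → Ω → ℝ} {θstar : Vec p}
  {𝒳 : ℕ → Set (Vec p)} {X θhat : ℕ → Ω → Vec p} {ω : Ω}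

/-- If the potential is at least `1`, the trivial bound `2 * B` is enough. Otherwise `θ - θstar` is
split at the centre `θhat`, and each half costs `√(2 * β)` times the root of the potential; the `2`
appears because the radius bounds half of the squared norm. -/
theorem instant_regret_le (hd : 1 ≤ d) (hB : 0 < B)
    (h𝒳 : ∀ t, 1 ≤ t → 𝒳 t ⊆ Metric.closedBall (0 : Vec p) 1)
    (hθ : θstar ∈ Metric.closedBall (0 : Vec p) B)
    (halg : IsMixingLinUCB d B (1 / B ^ 2) δ φ θstar ε 𝒳 X θhat) (hβ : B ≤ √(2 * β))
    (hC : ∀ t, 1 ≤ t → t + d ≤ T →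
      θstar ∈ confSet d B (1 / B ^ 2) δ φ (fun s => X s ω) (θhat t ω) t ∧
      confRadius p d B (1 / B ^ 2) δ φ t ≤ β)
    {i k : ℕ} (hi : i ∈ Finset.Icc 1 d) (hk : 1 ≤ k) (hT : i + k * d ≤ T) :
    ⨆ y : 𝒳 (i + k * d), (inner ℝ (y : Vec p) θstar - inner ℝ (X (i + k * d) ω) θstar)
      ≤ 2 * √(2 * β) * √(min 1 (potential (1 / B ^ 2) (fun j => X (i + j * d) ω) k)) := by
  have hi' := Finset.mem_Icc.1 hi
  have hkd : d ≤ k * d := Nat.le_mul_of_pos_left d hk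
  have hlam : 0 < 1 / B ^ 2 := by positivity
  set y : ℕ → Vec p := fun j => X (i + j * d) ω with hy
  have hw := potential_nonneg hlam y k
  rcases le_total 1 (potential (1 / B ^ 2) y k) with h | h
  · rw [min_eq_left h, Real.sqrt_one, mul_one]
    refine (iSup_inner_sub_le_two_mul (h𝒳 _ (by omega)) (by simpa using hθ)
      (halg.mem _ (by omega) ω)).trans ?_
    linarith
  · rw [min_eq_right h]
    obtain ⟨hmem, hrad⟩ := hC (i + k * d - d) (by omega) (by omega)
    refine iSup_inner_sub_le (fun θ hθ => hθ.1) hmem (halg.mem _ (by omega) ω)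
      (halg.optimistic _ (by omega) ω) fun θ hθS => ?_
    have hbd : ∀ θ' ∈ confSet d B (1 / B ^ 2) δ φ (fun s => X s ω)
        (θhat (i + k * d - d) ω) (i + k * d - d),
        weightedNormSq (gram (1 / B ^ 2) y k) (θ' - θhat (i + k * d - d) ω) ≤ 2 * β := by
      intro θ' hθ'
      have h1 := weightedNormSq_gram_block_le hd (1 / B ^ 2) (fun s => X s ω) hi hk
        (θ' - θhat (i + k * d - d) ω)
      have h2 := hθ'.2
      refine h1.trans ?_
      linarith
    have h1 := inner_le_sqrt_potential hlam y k (hbd θ hθS)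
    have h2 : inner ℝ (y k) (θhat (i + k * d - d) ω - θstar)
        ≤ √(2 * β) * √(potential (1 / B ^ 2) y k) := by
      refine inner_le_sqrt_potential hlam y k ?_
      have h3 := hbd θstar hmem
      rw [weightedNormSq_gram] at h3 ⊢
      rw [norm_sub_rev]
      refine le_trans (le_of_eq ?_) h3
      congr 1
      refine Finset.sum_congr rfl fun j _ => ?_
      rw [← neg_sub θstar, inner_neg_left, neg_sq]
    have h4 : inner ℝ (X (i + k * d) ω) (θ - θstar)
        = inner ℝ (y k) (θ - θhat (i + k * d - d) ω)
          + inner ℝ (y k) (θhat (i + k * d - d) ω - θstar) := by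
      rw [← inner_add_right, sub_add_sub_cancel]
    rw [h4]
    linarith

theorem regret_le (hd : 1 ≤ d) (hp : 1 ≤ p) (hB : 0 < B)
    (h𝒳 : ∀ t, 1 ≤ t → 𝒳 t ⊆ Metric.closedBall (0 : Vec p) 1)
    (hθ : θstar ∈ Metric.closedBall (0 : Vec p) B)
    (halg : IsMixingLinUCB d B (1 / B ^ 2) δ φ θstar ε 𝒳 X θhat) (hβ : B ≤ √(2 * β))
    (hC : ∀ t, 1 ≤ t → t + d ≤ T →
      θstar ∈ confSet d B (1 / B ^ 2) δ φ (fun s => X s ω) (θhat t ω) t ∧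
      confRadius p d B (1 / B ^ 2) δ φ t ≤ β) :
    regret θstar 𝒳 X T ω
      ≤ 2 * B * d + 2 * √(2 * β) * (√T * √(d * (2 * p * Real.log (p + B ^ 2 * T)))) := by
  have hlam : 0 < 1 / B ^ 2 := by positivity
  set n : ℕ → ℕ := fun i => (T + d - i) / d with hn
  set v : ℕ → ℕ → ℝ := fun i k =>
    min 1 (potential (1 / B ^ 2) (fun j => X (i + j * d) ω) k) with hv
  have hv0 : ∀ i k, 0 ≤ v i k := fun i k => le_min zero_le_one (potential_nonneg hlam _ _)
  have hXn : ∀ t, 1 ≤ t → ‖X t ω‖ ≤ 1 := fun t ht => by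
    simpa using h𝒳 t ht (halg.mem t ht ω)
  -- The indices `k = 0` are the first `d` rounds, played without data; they account for `2 * B *
  -- d`, also when `d` exceeds `T`.
  have hterm : ∀ i ∈ Finset.Icc 1 d, ∀ k ∈ Finset.range (n i),
      ⨆ y : 𝒳 (i + k * d), (inner ℝ (y : Vec p) θstar - inner ℝ (X (i + k * d) ω) θstar)
        ≤ (if k = 0 then 2 * B else 0) + 2 * √(2 * β) * √(v i k) := by
    intro i hi k hk
    have hi' := Finset.mem_Icc.1 hi
    have hk' := Finset.mem_range.1 hk
    rcases Nat.eq_zero_or_pos k with rfl | hk0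
    · rw [if_pos rfl]
      refine (iSup_inner_sub_le_two_mul (h𝒳 _ (by omega)) (by simpa using hθ)
        (halg.mem _ (by omega) ω)).trans (le_add_of_nonneg_right (by positivity))
    · rw [if_neg hk0.ne', zero_add]
      refine instant_regret_le hd hB h𝒳 hθ halg hβ hC hi hk0 ?_
      simp only [hn] at hk'
      rw [Nat.lt_iff_add_one_le, Nat.le_div_iff_mul_le hd, add_mul, one_mul] at hk'
      omega
  have hcount : ∑ i ∈ Finset.Icc 1 d, ∑ k ∈ Finset.range (n i), (1 : ℝ) ^ 2 = T := by
    have := sum_Icc_eq_sum_blocks hd T (fun _ => (1 : ℝ))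
    simp only [one_pow]
    rw [← this]
    simp
  have hpot : ∑ i ∈ Finset.Icc 1 d, ∑ k ∈ Finset.range (n i), √(v i k) ^ 2
      ≤ d * (2 * p * Real.log (p + B ^ 2 * T)) := by
    calc _ ≤ ∑ i ∈ Finset.Icc 1 d, 2 * p * Real.log (p + B ^ 2 * T) := by
          refine Finset.sum_le_sum fun i hi => ?_
          have hi' := Finset.mem_Icc.1 hi
          have h1 := sum_min_potential_le hlam (y := fun j => X (i + j * d) ω) (n := n i)
            (fun k _ => hXn _ (by omega))
          simp_rw [Real.sq_sqrt (hv0 i _)]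
          refine h1.trans ?_
          have h2 : (n i : ℝ) / (1 / B ^ 2) ≤ B ^ 2 * T := by
            rw [div_div_eq_mul_div, div_one, mul_comm]
            gcongr
            have h3 : (n i) * d ≤ T + d - 1 :=
              (Nat.div_mul_le_self _ _).trans (by omega)
            by_contra! hcon
            have : (T + 1) * d ≤ n i * d := Nat.mul_le_mul_right d hcon
            have : T ≤ T * d := Nat.le_mul_of_pos_right T hd
            rw [add_mul] at *
            omega
          have hp0 : (1 : ℝ) ≤ p := by exact_mod_cast hp
          gcongr
      _ = _ := by simp
  have hCS : ∑ i ∈ Finset.Icc 1 d, ∑ k ∈ Finset.range (n i), √(v i k)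
      ≤ √T * √(d * (2 * p * Real.log (p + B ^ 2 * T))) := by
    have h1 := Real.sum_mul_le_sqrt_mul_sqrt
      ((Finset.Icc 1 d).sigma fun i => Finset.range (n i)) (fun _ => (1 : ℝ))
      (fun z => √(v z.1 z.2))
    simp only [Finset.sum_sigma, one_mul] at h1
    rw [hcount] at h1
    refine h1.trans ?_
    gcongr
  rw [regret, sum_Icc_eq_sum_blocks hd]
  calc _ ≤ ∑ i ∈ Finset.Icc 1 d, ∑ k ∈ Finset.range (n i),
        ((if k = 0 then 2 * B else 0) + 2 * √(2 * β) * √(v i k)) :=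
        Finset.sum_le_sum fun i hi => Finset.sum_le_sum fun k hk => hterm i hi k hk
    _ = ∑ i ∈ Finset.Icc 1 d, ∑ k ∈ Finset.range (n i), (if k = 0 then 2 * B else 0)
        + 2 * √(2 * β) * ∑ i ∈ Finset.Icc 1 d, ∑ k ∈ Finset.range (n i), √(v i k) := by
        simp only [Finset.sum_add_distrib, Finset.mul_sum]
    _ ≤ 2 * B * d + 2 * √(2 * β) * (√T * √(d * (2 * p * Real.log (p + B ^ 2 * T)))) := by
        gcongr
        calc _ ≤ ∑ i ∈ Finset.Icc 1 d, 2 * B := by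
              refine Finset.sum_le_sum fun i _ => ?_
              rw [Finset.sum_ite_eq' (Finset.range (n i)) 0 fun _ => 2 * B]
              split_ifs
              · exact le_rfl
              · positivity
          _ = 2 * B * d := by simp [mul_comm]

end Regret

/-! ### Comparison of the rates -/

theorem tendsto_log_natCast : Tendsto (fun T : ℕ => Real.log T) atTop atTop :=
  Real.tendsto_log_atTop.comp tendsto_natCast_atTop_atTop

theorem eventually_log_mul {c : ℝ} (hc : 0 < c) :
    ∀ᶠ T : ℕ in atTop, Real.log T / 2 ≤ Real.log (T * c) ∧ Real.log (T * c) ≤ 2 * Real.log T := by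
  filter_upwards [tendsto_log_natCast.eventually_ge_atTop (2 * |Real.log c|),
    eventually_ge_atTop 1] with T hT hT1
  have hT0 : (0 : ℝ) < T := by exact_mod_cast hT1
  rw [Real.log_mul hT0.ne' hc.ne']
  have h1 := neg_abs_le (Real.log c)
  have h2 := le_abs_self (Real.log c)
  have h3 := abs_nonneg (Real.log c)
  constructor <;> linarith

theorem eventually_log_le (a b : ℝ) {c : ℝ} (hc : 0 < c) :
    ∀ᶠ T : ℕ in atTop, a * Real.log T + b ≤ c * T := by
  have h1 : (fun x : ℝ => a * Real.log x + b) =o[atTop] (fun x : ℝ => x) :=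
    (Real.isLittleO_log_id_atTop.const_mul_left a).add (Asymptotics.isLittleO_const_id_atTop b)
  have h2 := tendsto_natCast_atTop_atTop.eventually (h1.bound hc)
  filter_upwards [h2] with T hT
  rw [Real.norm_eq_abs, Real.norm_of_nonneg (Nat.cast_nonneg T)] at hT
  exact (le_abs_self _).trans hT

theorem geometricRate_equiv_iidRate {p : ℕ} {B C τ δ : ℝ} (hp : 1 ≤ p) (hB : 0 < B) (hC : 0 < C)
    (hτ : 0 < τ) :
    ∀ᶠ T : ℕ in atTop,
      geometricRate p B C τ δ T ≤ 52 * (τ * Real.log T * iidRate p B δ T) ∧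
        τ * Real.log T * iidRate p B δ T ≤ 52 * geometricRate p B C τ δ T := by
  have hp0 : (1 : ℝ) ≤ p := by exact_mod_cast hp
  have hm : 0 < max 1 C := lt_max_of_lt_left one_pos
  filter_upwards [eventually_log_mul (c := B * max 1 C / p) (by positivity),
    eventually_log_mul (c := B * C / p) (by positivity),
    eventually_log_mul (c := B / p) (by positivity),
    tendsto_log_natCast.eventually_ge_atTop 2,
    tendsto_log_natCast.eventually_ge_atTop (2 / √τ),
    tendsto_natCast_atTop_atTop.eventually_ge_atTop (B ^ 2)] with T ha hb he hl hlτ hBT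
  have h1 : (T : ℝ) * B * max 1 C / p = T * (B * max 1 C / p) := by ring
  have h2 : B * C * (T : ℝ) / p = T * (B * C / p) := by ring
  have h3 : (T : ℝ) * B / p = T * (B / p) := by ring
  rw [geometricRate, iidRate, h1, h2, h3, Real.sqrt_mul (Nat.cast_nonneg T)]
  set l := Real.log T
  set a := Real.log (T * (B * max 1 C / p))
  set b := Real.log (T * (B * C / p))
  set e := Real.log (T * (B / p))
  set s := √(p * T * Real.log (T * B / (p * δ)))
  have hs : 0 ≤ s := Real.sqrt_nonneg _
  set q := √(T : ℝ) with hq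
  have hq0 : 0 ≤ q := Real.sqrt_nonneg _
  have hBq : B ≤ q := Real.le_sqrt_of_sq_le hBT
  have hsτ : 0 < √τ := Real.sqrt_pos.2 hτ
  have hτ2 : τ = √τ * √τ := (Real.mul_self_sqrt hτ.le).symm
  have ha1 : 1 ≤ a := by linarith [ha.1]
  have he0 : 0 ≤ e := by linarith [he.1]
  have hl0 : 0 ≤ l := by linarith
  constructor
  · have t1 : τ * p * q * a ^ 2 ≤ 8 * (τ * l * (p * q * e)) := by
      calc τ * p * q * a ^ 2 ≤ τ * p * q * (2 * l) ^ 2 := by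
            gcongr
            exact ha.2
        _ = 4 * (τ * p * q * l) * l := by ring
        _ ≤ 4 * (τ * p * q * l) * (2 * e) := by
            gcongr
            linarith [he.1]
        _ = _ := by ring
    have t2 : p * (q * √τ) * a ≤ 2 * (τ * l * (p * q * e)) := by
      -- The second term of the geometric rate is dominated once `log T ≥ 2 / √τ`, a threshold that
      -- may depend on `τ` here.
      have h4 : √τ ≤ τ * e := by
        have h5 : 1 / √τ ≤ e := by
          have : 2 / √τ = 2 * (1 / √τ) := by ring
          linarith [he.1]
        calc √τ = τ * (1 / √τ) := by
              nth_rewrite 2 [hτ2]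
              field_simp
          _ ≤ τ * e := by gcongr
      calc p * (q * √τ) * a ≤ p * (q * (τ * e)) * (2 * l) := by
            gcongr
            exact ha.2
        _ = _ := by ring
    have t3 : τ * b * s ≤ 2 * (τ * l * s) := by
      calc τ * b * s ≤ τ * (2 * l) * s := by
            gcongr
            exact hb.2
        _ = _ := by ring
    have t4 : 0 ≤ τ * l * B := by positivity
    have t5 : 0 ≤ τ * l * s := by positivity
    have t6 : 0 ≤ τ * l * (p * q * e) := by positivity
    linarith
  · have hla : l ≤ 2 * a := by linarith [ha.1]
    have t1 : τ * l * B ≤ 2 * (τ * p * q * a ^ 2) := by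
      calc τ * l * B ≤ τ * (2 * a) * q := by gcongr
        _ = 2 * (τ * 1 * q * (a * 1)) := by ring
        _ ≤ 2 * (τ * p * q * (a * a)) := by gcongr
        _ = _ := by ring
    have t2 : τ * l * (p * q * e) ≤ 8 * (τ * p * q * a ^ 2) := by
      calc τ * l * (p * q * e) ≤ τ * (2 * a) * (p * q * (4 * a)) := by
            gcongr
            linarith [he.2]
        _ = _ := by ring
    have t3 : τ * l * s ≤ 2 * (τ * b * s) := by
      calc τ * l * s ≤ τ * (2 * b) * s := by
            gcongr
            linarith [hb.1]
        _ = _ := by ring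
    have t4 : 0 ≤ p * (q * √τ) * a := by positivity
    have t5 : 0 ≤ τ * b * s := by
      have : 0 ≤ b := by linarith [hb.1]
      positivity
    have t6 : 0 ≤ τ * p * q * a ^ 2 := by positivity
    linarith

/-! ### The regret of Mixing-LinUCB under geometric mixing -/

/-- The horizon `T` is large in terms of `p`, `B` and `δ`. -/
structure LargeHorizon (p : ℕ) (B δ : ℝ) (T : ℕ) : Prop where
  sq_dim_le : (p : ℝ) ^ 2 ≤ B ^ 2 * T
  log_le : 8 * (p / 2 * Real.log ((B + 1) ^ 2 * Real.exp 1 * T) + Real.log (T / δ))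
    ≤ (1 - ballMoment p) ^ 2 * (B ^ 2 * T)
  scale_le : (B + 1) ^ 2 * Real.exp 1 ≤ T
  inv_conf_le : 1 / δ ≤ T
  const_le_log : 2 + p * (B + 1) / B ≤ Real.log T
  sq_bound_le_log : B ^ 2 ≤ Real.log T
  potential_le : p + B ^ 2 * T ≤ (T : ℝ) ^ 2
  four_mul_le : 4 * B ^ 2 ≤ T

/-- Only `p, B, δ` occur, which is what makes `T₀` uniform in `C` and `τ`. The condition `log_le`
sets a logarithm against a linear function whose slope is positive because `ballMoment p < 1`. -/
theorem eventually_largeHorizon (p : ℕ) {B δ : ℝ} (hB : 0 < B) (hδ : 0 < δ) :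
    ∀ᶠ T : ℕ in atTop, LargeHorizon p B δ T := by
  have hκ : 0 < 1 - ballMoment p := by linarith [ballMoment_lt_one p]
  have hcast : ∀ c : ℝ, ∀ᶠ T : ℕ in atTop, c ≤ (T : ℝ) := fun c =>
    tendsto_natCast_atTop_atTop.eventually_ge_atTop c
  have hc : 0 < (1 - ballMoment p) ^ 2 * B ^ 2 := by positivity
  filter_upwards [hcast (p ^ 2 / B ^ 2), hcast ((B + 1) ^ 2 * Real.exp 1), hcast (1 / δ),
    tendsto_log_natCast.eventually_ge_atTop (2 + p * (B + 1) / B),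
    tendsto_log_natCast.eventually_ge_atTop (B ^ 2), hcast (p + B ^ 2), hcast (4 * B ^ 2),
    eventually_ge_atTop 1,
    eventually_log_le (8 * (p / 2 + 1))
      (8 * (p / 2 * Real.log ((B + 1) ^ 2 * Real.exp 1) - Real.log δ)) hc]
    with T h1 h2 h3 h4 h5 h6 h7 h8 h9
  have hT : (1 : ℝ) ≤ T := by exact_mod_cast h8
  refine ⟨?_, ?_, h2, h3, h4, h5, ?_, h7⟩
  · rw [div_le_iff₀ (by positivity)] at h1
    linarith
  · rw [Real.log_mul (by positivity) (by positivity), Real.log_div (by positivity) hδ.ne']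
    linarith
  · have : (p : ℝ) ≤ p * T := le_mul_of_one_le_right (by positivity) hT
    nlinarith

/-- The delay is tuned so that `e^{-d/τ} ≤ p / (B C T)`; the constant `C` cancels. -/
theorem geometricCoeff_delay_mul_le {p : ℕ} {B C τ : ℝ} {T : ℕ} (hp : 1 ≤ p) (hB : 0 < B)
    (hC : 0 < C) (hτ : 0 < τ) (hT : 1 ≤ T) :
    geometricCoeff C τ (geometricDelay p B C τ T) * (B * T) ≤ p := by
  have hp0 : (0 : ℝ) < p := by exact_mod_cast hp
  have hT0 : (0 : ℝ) < T := by exact_mod_cast hT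
  have hpos : 0 < B * C * T / p := by positivity
  have h1 : τ * Real.log (B * C * T / p) ≤ geometricDelay p B C τ T := Nat.le_ceil _
  have h2 : Real.exp (-(geometricDelay p B C τ T : ℝ) / τ) ≤ (B * C * T / p)⁻¹ := by
    rw [← Real.exp_log hpos, ← Real.exp_neg]
    refine Real.exp_le_exp.2 ?_
    rw [div_le_iff₀ hτ]
    linarith
  rw [geometricCoeff]
  calc C * Real.exp (-(geometricDelay p B C τ T : ℝ) / τ) * (B * T)
      ≤ C * (B * C * T / p)⁻¹ * (B * T) := by gcongr
    _ = p := by field_simp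

theorem confRadius_le {p d t T : ℕ} {B δ : ℝ} {φ : ℕ → ℝ} (hp : 1 ≤ p) (hd : 1 ≤ d) (hB : 0 < B)
    (hδ : 0 < δ) (hT : LargeHorizon p B δ T) (hφ0 : 0 ≤ φ d) (hφ : φ d * (B * T) ≤ p)
    (htT : t + d ≤ T) :
    confRadius p d B (1 / B ^ 2) δ φ t ≤ 4 * (d * p * Real.log T) := by
  have hd0 : (1 : ℝ) ≤ d := by exact_mod_cast hd
  have hp0 : (1 : ℝ) ≤ p := by exact_mod_cast hp
  have htT' : (t : ℝ) ≤ T := by exact_mod_cast (by omega : t ≤ T)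
  have hT0 : (0 : ℝ) < T := by exact_mod_cast (by omega : 0 < T)
  have hdp : 1 ≤ (d : ℝ) * p := one_le_mul_of_one_le_of_one_le hd0 hp0
  have hl : 0 ≤ Real.log T := le_trans (by positivity) hT.const_le_log
  have h1 := logRadius_le (B := B) hp hd hB hδ htT
  have h2 : Real.log ((B + 1) ^ 2 * Real.exp 1 * T) ≤ 2 * Real.log T := by
    rw [Real.log_mul (by positivity) hT0.ne']
    have := Real.log_le_log (by positivity) hT.scale_le
    linarith
  have h3 : Real.log (T / δ) ≤ 2 * Real.log T := by
    rw [div_eq_mul_one_div, Real.log_mul hT0.ne' (by positivity)]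
    have := Real.log_le_log (by positivity) hT.inv_conf_le
    linarith
  have h4 : logRadius p d B δ t ≤ 3 * (d * p * Real.log T) := by
    calc logRadius p d B δ t
        ≤ d * (p / 2 * Real.log ((B + 1) ^ 2 * Real.exp 1 * T) + Real.log (T / δ)) := h1
      _ ≤ d * (p / 2 * (2 * Real.log T) + 2 * Real.log T) := by gcongr
      _ = d * (p + 2 * 1) * Real.log T := by ring
      _ ≤ d * (p + 2 * p) * Real.log T := by gcongr
      _ = _ := by ring
  have h5 : t * φ d * (B + 1) ≤ p * (B + 1) / B := by
    rw [le_div_iff₀ hB]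
    calc t * φ d * (B + 1) * B ≤ T * φ d * (B + 1) * B := by gcongr
      _ = φ d * (B * T) * (B + 1) := by ring
      _ ≤ p * (B + 1) := by gcongr
  have h6 : Real.log T ≤ d * p * Real.log T := le_mul_of_one_le_left hl hdp
  have h7 : confRadius p d B (1 / B ^ 2) δ φ t
      = logRadius p d B δ t + 2 + t * φ d * (B + 1) := by
    rw [confRadius, logRadius]
    have : 2 * (1 / B ^ 2) * B ^ 2 = 2 := by field_simp
    rw [this]
    ring
  rw [h7]
  linarith [hT.const_le_log]

theorem regret_bound_le {p d T : ℕ} {B δ : ℝ} (hp : 1 ≤ p) (hB : 0 < B)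
    (hT : LargeHorizon p B δ T) :
    2 * B * d + 2 * √(2 * (4 * (d * p * Real.log T)))
        * (√T * √(d * (2 * p * Real.log (p + B ^ 2 * T))))
      ≤ 13 * (d * p * √T * Real.log T) := by
  have hp0 : (1 : ℝ) ≤ p := by exact_mod_cast hp
  have hl : 1 ≤ Real.log T := by
    have : 0 ≤ p * (B + 1) / B := by positivity
    linarith [hT.const_le_log]
  have hT0 : (0 : ℝ) ≤ T := T.cast_nonneg
  have h1 : Real.log (p + B ^ 2 * T) ≤ 2 * Real.log T := by
    have := Real.log_le_log (by positivity) hT.potential_le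
    rwa [Real.log_pow, Nat.cast_ofNat] at this
  set x := d * p * Real.log T with hx
  have hx0 : 0 ≤ x := by positivity
  -- The product is at most `√32 * x`. Rounding up to `6 * x`, doubling it and adding the `2 * B *
  -- d` term gives the constant `13`.
  have h2 : √(2 * (4 * x)) * √(d * (2 * p * Real.log (p + B ^ 2 * T))) ≤ 6 * x := by
    rw [← Real.sqrt_mul (by positivity)]
    refine Real.sqrt_le_iff.2 ⟨by positivity, ?_⟩
    calc 2 * (4 * x) * (d * (2 * p * Real.log (p + B ^ 2 * T)))
        ≤ 2 * (4 * x) * (d * (2 * p * (2 * Real.log T))) := by gcongr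
      _ = 32 * x ^ 2 := by rw [hx]; ring
      _ ≤ (6 * x) ^ 2 := by nlinarith [sq_nonneg x]
  have h3 : 2 * B ≤ √T := by
    refine Real.le_sqrt_of_sq_le ?_
    linarith [hT.four_mul_le]
  have h4 : 2 * B * d ≤ √T * x := by
    calc 2 * B * d ≤ √T * (d * 1 * 1) := by
          rw [mul_one, mul_one]
          gcongr
      _ ≤ √T * (d * p * Real.log T) := by gcongr
  calc _ = 2 * B * d + 2 * √T * (√(2 * (4 * x)) * √(d * (2 * p * Real.log (p + B ^ 2 * T)))) := by
        ring
    _ ≤ √T * x + 2 * √T * (6 * x) := by gcongr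
    _ = _ := by rw [hx]; ring

/-- The first term of the rate alone suffices. Rounding up at most doubles `τ log (B C T / p) ≥ 1`,
and `p² ≤ B² T` gives `log T ≤ 2 * L`; hence the factor `4`. -/
theorem delay_mul_le_geometricRate {p T : ℕ} {B C τ δ : ℝ} (hp : 1 ≤ p) (hB : 0 < B) (hC : 0 < C)
    (hτ : 0 < τ) (hT : LargeHorizon p B δ T) (hlog : 1 ≤ τ * Real.log (B * C * T / p)) :
    geometricDelay p B C τ T * p * √T * Real.log T ≤ 4 * geometricRate p B C τ δ T := by
  have hp0 : (1 : ℝ) ≤ p := by exact_mod_cast hp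
  have hl : 1 ≤ Real.log T := by
    have : 0 ≤ p * (B + 1) / B := by positivity
    linarith [hT.const_le_log]
  have hT0 : (0 : ℝ) < T := by
    have : (0 : ℝ) < (B + 1) ^ 2 * Real.exp 1 := by positivity
    linarith [hT.scale_le]
  set L := Real.log (T * B * max 1 C / p) with hL
  have h1 : Real.log (B * C * T / p) ≤ L := by
    refine Real.log_le_log (by positivity) ?_
    rw [mul_comm (B * C), ← mul_assoc]
    gcongr
    exact le_max_right _ _
  have h2 : Real.log T ≤ 2 * L := by
    have h3 : (T : ℝ) ≤ (T * B * max 1 C / p) ^ 2 := by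
      rw [div_pow, le_div_iff₀ (by positivity)]
      calc (T : ℝ) * p ^ 2 ≤ T * (B ^ 2 * T) := by
            gcongr
            exact hT.sq_dim_le
        _ = (T * B * 1) ^ 2 := by ring
        _ ≤ (T * B * max 1 C) ^ 2 := by
            gcongr
            exact le_max_left _ _
    have := Real.log_le_log hT0 h3
    rwa [Real.log_pow, Nat.cast_ofNat] at this
  have hL0 : 0 ≤ L := by linarith
  have h4 : (geometricDelay p B C τ T : ℝ) ≤ 2 * (τ * L) := by
    have h5 := (Nat.ceil_lt_add_one (by linarith : 0 ≤ τ * Real.log (B * C * T / p))).le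
    have h6 : τ * Real.log (B * C * T / p) ≤ τ * L := by gcongr
    rw [geometricDelay]
    linarith
  have h7 : τ * p * √T * L ^ 2 ≤ geometricRate p B C τ δ T := by
    have h8 : 0 ≤ p * √(T * τ) * L := by positivity
    have h9 : 0 ≤ τ * Real.log (B * C * T / p) * √(p * T * Real.log (T * B / (p * δ))) :=
      mul_nonneg (by linarith) (Real.sqrt_nonneg _)
    rw [geometricRate]
    linarith
  calc geometricDelay p B C τ T * p * √T * Real.log T
      ≤ 2 * (τ * L) * p * √T * (2 * L) := by gcongr
    _ = 4 * (τ * p * √T * L ^ 2) := by ring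
    _ ≤ _ := by gcongr

theorem regret_le_of_largeHorizon {Ω : Type*} [MeasurableSpace Ω] {μ : Measure Ω}
    [IsProbabilityMeasure μ] {p T : ℕ} {B C τ δ : ℝ} {ε : ℕ → Ω → ℝ} {θstar : Vec p}
    {𝒳 : ℕ → Set (Vec p)} {X θhat : ℕ → Ω → Vec p} (hp : 1 ≤ p) (hB : 0 < B) (hδ : 0 < δ)
    (hδ1 : δ < 1) (hC : 0 < C) (hτ : 0 < τ) (hT : LargeHorizon p B δ T)
    (hlog : 1 ≤ τ * Real.log (B * C * T / p))
    (hnoise : MixingSubGaussian μ 1 (geometricCoeff C τ) ε)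
    (hθ : θstar ∈ Metric.closedBall (0 : Vec p) B)
    (h𝒳 : ∀ t, 1 ≤ t → 𝒳 t ⊆ Metric.closedBall (0 : Vec p) 1)
    (halg : IsMixingLinUCB (geometricDelay p B C τ T) B (1 / B ^ 2) δ
      (geometricCoeff C τ) θstar ε 𝒳 X θhat) :
    1 - δ ≤ μ.real {ω | regret θstar 𝒳 X T ω ≤ 52 * geometricRate p B C τ δ T} := by
  have hp0 : (1 : ℝ) ≤ p := by exact_mod_cast hp
  have hl : 1 ≤ Real.log T := by
    have : 0 ≤ p * (B + 1) / B := by positivity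
    linarith [hT.const_le_log]
  have hT1 : 1 ≤ T := by
    rcases Nat.eq_zero_or_pos T with rfl | h
    · norm_num at hl
    · exact h
  set d := geometricDelay p B C τ T with hd
  set φ := geometricCoeff C τ with hφdef
  have hd1 : 1 ≤ d := Nat.one_le_iff_ne_zero.2 (Nat.ceil_pos.2 (by linarith)).ne'
  have hφ0 : 0 ≤ φ d := hnoise.coeff_nonneg d
  have hφ : φ d * (B * T) ≤ p := geometricCoeff_delay_mul_le hp hB hC hτ hT1
  have hdp : 1 ≤ (d : ℝ) * p :=
    one_le_mul_of_one_le_of_one_le (by exact_mod_cast hd1) hp0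
  have hβ : B ≤ √(2 * (4 * (d * p * Real.log T))) := by
    refine Real.le_sqrt_of_sq_le ?_
    have : Real.log T ≤ d * p * Real.log T := le_mul_of_one_le_left (by linarith) hdp
    linarith [hT.sq_bound_le_log]
  have hQ := isProbabilityMeasure_shiftedPrior (p := p) hB θstar
  have hbad := measure_bad_le hnoise hd1 halg.measurable (shiftedPrior B θstar) hδ T
  set G := {ω | regret θstar 𝒳 X T ω ≤ 52 * geometricRate p B C τ δ T} with hG
  have hGc : μ Gᶜ ≤ ENNReal.ofReal δ := by
    refine (measure_mono fun ω hω => ?_).trans hbad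
    rintro ⟨hm, hmix⟩
    refine hω ?_
    have hreg := regret_le (T := T) (ω := ω) hd1 hp hB h𝒳 hθ halg hβ fun t ht htT =>
      ⟨mem_confSet_of_mixture_lt hp hd1 hB hδ hδ1
        (fun s hs => by simpa using h𝒳 s hs (halg.mem s hs ω)) hθ (halg.estimate_mem t ht ω)
        (halg.estimate_min t ht ω) hm hmix htT hφ0 hφ hT.sq_dim_le hT.log_le,
      confRadius_le hp hd1 hB hδ hT hφ0 hφ htT⟩
    have h1 := regret_bound_le (d := d) hp hB hT
    have h2 := delay_mul_le_geometricRate hp hB hC hτ hT hlog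
    exact hreg.trans (h1.trans (by linarith))
  have h1 : μ.real Gᶜ ≤ δ := ENNReal.toReal_le_of_le_ofReal hδ.le hGc
  -- Subadditivity replaces additivity, so the regret event need not be measurable.
  have h2 : 1 ≤ μ.real G + μ.real Gᶜ := by
    have := measureReal_union_le (μ := μ) G Gᶜ
    rwa [Set.union_compl_self, probReal_univ] at this
  linarith

end MixingBandit

end

theorem corollary2 :
    ∃ K : ℝ, 0 < K ∧
      -- the regret bound, with probability at least `1 - δ`
      (∀ (p : ℕ) (B δ : ℝ), 1 ≤ p → 0 < B → 0 < δ → δ < 1 →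
        ∃ T₀ : ℕ, ∀ (C τ : ℝ) (T : ℕ), 0 < C → 0 < τ → T₀ ≤ T →
          1 ≤ τ * Real.log (B * C * T / p) →
          ∀ (Ω : Type u) [MeasurableSpace Ω] (μ : MeasureTheory.Measure Ω)
            [MeasureTheory.IsProbabilityMeasure μ]
            (ε : ℕ → Ω → ℝ) (θstar : MixingBandit.Vec p) (𝒳 : ℕ → Set (MixingBandit.Vec p))
            (X θhat : ℕ → Ω → MixingBandit.Vec p),
            MixingBandit.MixingSubGaussian μ 1 (MixingBandit.geometricCoeff C τ) ε →
            θstar ∈ Metric.closedBall (0 : MixingBandit.Vec p) B →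
            (∀ t, 1 ≤ t → 𝒳 t ⊆ Metric.closedBall (0 : MixingBandit.Vec p) 1) →
            MixingBandit.IsMixingLinUCB (MixingBandit.geometricDelay p B C τ T) B (1 / B ^ 2) δ
              (MixingBandit.geometricCoeff C τ) θstar ε 𝒳 X θhat →
            1 - δ ≤ μ.real {ω | MixingBandit.regret θstar 𝒳 X T ω
              ≤ K * MixingBandit.geometricRate p B C τ δ T}) ∧
      -- this rate is the i.i.d. rate up to a factor of order `τ log T`
      (∀ (p : ℕ) (B C τ δ : ℝ), 1 ≤ p → 0 < B → 0 < C → 0 < τ → 0 < δ → δ < 1 →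
        ∀ᶠ T : ℕ in Filter.atTop,
          MixingBandit.geometricRate p B C τ δ T
              ≤ K * (τ * Real.log T * MixingBandit.iidRate p B δ T) ∧
            τ * Real.log T * MixingBandit.iidRate p B δ T
              ≤ K * MixingBandit.geometricRate p B C τ δ T) := by
  -- `52 = 13 * 4` comes from the regret bound; the comparison of the rates would hold with a
  -- smaller constant.
  refine ⟨52, by norm_num, fun p B δ hp hB hδ hδ1 => ?_, fun p B C τ δ hp hB hC hτ _ _ =>
    MixingBandit.geometricRate_equiv_iidRate hp hB hC hτ⟩
  obtain ⟨T₀, hT₀⟩ := Filter.eventually_atTop.1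
    (MixingBandit.eventually_largeHorizon p hB hδ)
  refine ⟨T₀, fun C τ T hC hτ hT hlog Ω _ μ _ ε θstar 𝒳 X θhat hnoise hθ h𝒳 halg => ?_⟩
  exact MixingBandit.regret_le_of_largeHorizon hp hB hδ hδ1 hC hτ (hT₀ T hT) hlog hnoise hθ
    h𝒳 halg
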